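/- Let $n\ge 2$, $\mu\in(0,1)$, $c\in[0,\mu)$ and $\bar U=(\mu-c)/\mu$. Consider the following game between $n$ firms and one consumer. Simultaneously, each firm $i$ posts a price $p_i\ge 0$ and a signal, i.e. a probability distribution $F_i$ of posterior expected match values that is supported in $[0,1]$ and has mean $\mu$; firms may mix, independently of each other, over pairs (price, signal). The consumer observes all posted prices and signals and then searches sequentially, with recall: visiting firm $i$ costs $c$ and reveals its posterior value $x_i$, where $x_1,\dots,x_n$ are independent with $x_i\sim F_i$; at any time she may buy from a firm already visited, which ends the search and gives her $x_i-p_i$, or stop without buying, which gives her $0$, in both cases minus $c$ for every visit made. A firm earns its price if the consumer buys from it, and $0$ otherwise. A symmetric equilibrium consists of one mixed strategy $\sigma$ played by all firms and a strategy of the consumer that, for all posted offers and after every history of the search, maximizes her expected continuation payoff, such that no firm can increase its expected profit by a unilateral deviation from $\sigma$. A symmetric equilibrium exists, and the strategy $\sigma$ of the firms is the same in all symmetric equilibria. Under $\sigma$, every firm almost surely provides full information (its signal puts probability $\mu$ on $1$ and $1-\mu$ on $0$), and its price is distributed with support $\left[(1-\mu)^{n-1}\bar U,\ \bar U\right]$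 and distribution function \[\Phi(p)=\frac1\mu-\frac{1-\mu}{\mu}\left(\frac{\bar U}{p}\right)^{\frac1{n-1}},\qquad p\in\left[(1-\mu)^{n-1}\bar U,\ \bar U\right].\] -/

import Mathlib

open MeasureTheory
open scoped NNReal

noncomputable section

namespace SearchMarket

/-- `F` is a Bayes-plausible distribution over posterior expected match values: a probability
measure concentrated on `[0, 1]` whose mean is the prior mean `μ`. -/
def IsBayesPlausible (μ : ℝ) (F : Measure ℝ) : Prop :=
  IsProbabilityMeasure F ∧ F (Set.Icc 0 1)ᶜ = 0 ∧ ∫ x, x ∂F = μ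

/-- The signals available to a firm: the Bayes-plausible distributions over posteriors. -/
abbrev Signal (μ : ℝ) : Type := {F : Measure ℝ // IsBayesPlausible μ F}

/-- A pure strategy of a firm: a nonnegative price together with a signal. -/
abbrev Offer (μ : ℝ) : Type := ℝ≥0 × Signal μ

/-- The posted price, as a real number. -/
def price {μ : ℝ} (a : Offer μ) : ℝ := a.1

/-- The posted distribution over posteriors. -/
def signal {μ : ℝ} (a : Offer μ) : Measure ℝ := a.2

/-- The fully revealing distribution over posteriors: `1` with probability `μ`, else `0`. -/
def fullInformation (μ : ℝ) : Measure ℝ :=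
  ENNReal.ofReal (1 - μ) • Measure.dirac 0 + ENNReal.ofReal μ • Measure.dirac 1

/-- A (behavioural) search plan of the consumer, for given posted offers. A history is the list
`l` of the firms visited so far (most recent first) together with the posteriors `x j`, `j ∈ l`,
observed there. `δ l x (some j)` is the probability of choosing firm `j` next: this is a visit
to `j` if `j ∉ l`, and a purchase from `j`, which ends the search, if `j ∈ l`. `δ l x none` is
the probability of ending the search with the outside option. -/
abbrev SearchPlan (n : ℕ) : Type := List (Fin n) → (Fin n → ℝ) → Option (Fin n) → ℝ

/-- The plan prescribes probabilities that depend (measurably) only on what was observed. -/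
structure IsSearchPlan {n : ℕ} (δ : SearchPlan n) : Prop where
  nonneg : ∀ l x a, 0 ≤ δ l x a
  sum_eq_one : ∀ l x, ∑ a, δ l x a = 1
  nonanticipating : ∀ l x y, (∀ j ∈ l, x j = y j) → δ l x = δ l y
  measurable : ∀ l a, Measurable fun x => δ l x a

/-- The probability that the consumer, from the history `l` on and with at most `k` further
visits, ends up buying from firm `i`, when the posteriors are `x`. -/
def purchaseProb {n : ℕ} (δ : SearchPlan n) (x : Fin n → ℝ) :
    ℕ → List (Fin n) → Fin n → ℝ
  | 0, l, i => if i ∈ l then δ l x (some i) else 0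
  | k + 1, l, i => (if i ∈ l then δ l x (some i) else 0) +
      ∑ j, if j ∈ l then 0 else δ l x (some j) * purchaseProb δ x k (j :: l) i

/-- The expected number of further visits from the history `l` on, of which there are at most
`k`, when the posteriors are `x`. -/
def expectedVisits {n : ℕ} (δ : SearchPlan n) (x : Fin n → ℝ) : ℕ → List (Fin n) → ℝ
  | 0, _ => 0
  | k + 1, l => ∑ j, if j ∈ l then 0 else δ l x (some j) * (1 + expectedVisits δ x k (j :: l))

/-- The consumer's expected payoff from the history with visited firms `l` and observed
posteriors `x j`, `j ∈ l`, on, net of search costs already sunk. The posteriors of the unvisited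
firms are drawn independently from their posted signals. -/
def continuationValue {n : ℕ} {μ : ℝ} (c : ℝ) (s : Fin n → Offer μ) (δ : SearchPlan n)
    (l : List (Fin n)) (x : Fin n → ℝ) : ℝ :=
  ∫ y, (let z : Fin n → ℝ := fun j => if j ∈ l then x j else y j
    (∑ i, purchaseProb δ z (n - l.length) l i * (z i - price (s i)))
      - c * expectedVisits δ z (n - l.length) l) ∂(Measure.pi fun j => signal (s j))

/-- A strategy of the consumer: a search plan for every profile of posted offers. -/
abbrev ConsumerStrategy (n : ℕ) (μ : ℝ) : Type := (Fin n → Offer μ) → SearchPlan n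

/-- The consumer's strategy is (jointly measurable and) sequentially rational: whatever offers are
posted and whatever history has been reached, no search plan does better from there on. -/
structure IsSequentiallyRational {n : ℕ} {μ : ℝ} (c : ℝ) (γ : ConsumerStrategy n μ) : Prop where
  isSearchPlan : ∀ s, IsSearchPlan (γ s)
  measurable : ∀ l a, Measurable fun z : (Fin n → Offer μ) × (Fin n → ℝ) => γ z.1 l z.2 a
  optimal : ∀ (s : Fin n → Offer μ) (l : List (Fin n)) (x : Fin n → ℝ), l.Nodup →
    (∀ j, x j ∈ Set.Icc (0 : ℝ) 1) → ∀ δ : SearchPlan n, IsSearchPlan δ →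
      continuationValue c s δ l x ≤ continuationValue c s (γ s) l x

/-- Firm `i`'s profit when the offers `s` are posted: price times probability of a sale. -/
def profit {n : ℕ} {μ : ℝ} (γ : ConsumerStrategy n μ) (s : Fin n → Offer μ) (i : Fin n) : ℝ :=
  price (s i) * ∫ x, purchaseProb (γ s) x n [] i ∂(Measure.pi fun j => signal (s j))

/-- Firm `i`'s expected profit when the firms independently play the mixed strategies `τ`. -/
def expectedProfit {n : ℕ} {μ : ℝ} (γ : ConsumerStrategy n μ) (τ : Fin n → Measure (Offer μ))
    (i : Fin n) : ℝ :=
  ∫ s, profit γ s i ∂(Measure.pi τ)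

/-- Symmetric equilibrium of the game in which prices and signals are posted: all firms play the
mixed strategy `σ`, the consumer plays `γ`, she is sequentially rational, and no firm has a
profitable deviation, to a mixed strategy `τ`. -/
structure IsSymmetricEquilibrium (n : ℕ) {μ : ℝ} (c : ℝ) (σ : Measure (Offer μ))
    (γ : ConsumerStrategy n μ) : Prop where
  isProbabilityMeasure : IsProbabilityMeasure σ
  sequentiallyRational : IsSequentiallyRational c γ
  noDeviation : ∀ (i : Fin n) (τ : Measure (Offer μ)), IsProbabilityMeasure τ →
    expectedProfit γ (Function.update (fun _ => σ) i τ) i ≤ expectedProfit γ (fun _ => σ) i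

/-- `Ū`, the reservation value of a fully revealing firm with price zero. -/
def maxReservation (μ c : ℝ) : ℝ := (μ - c) / μ

end SearchMarket

end

open ProbabilityTheory

noncomputable section

namespace SearchMarket

/-! The search game reduces to a static one. Let `r` be the reservation value of an offer, at which
the expected excess of the posterior `x` over `r` equals `c`, and put `W = min x r` (`truncated`)
and `w = W - p` (`netTruncated`). Weitzman's accounting identity `payoff_eq` writes the payoff of
any search plan as the net value `w` of what is bought, minus a nonnegative loss, plus a drift; the
drift has mean zero (`integral_mul_drift`). The index rule has no loss and always obtains the
largest of `0` and the `w i`. So a sequentially rational consumer almost surely buys only where `w`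
is maximal (`ae_optimal_purchase`).

A firm therefore chooses a price and a law of `W`. Whatever the signal, `W` lies in `[0, Ū]` and has
mean `μ - c = μ Ū` (`integral_truncated`), and full information puts `W` on the extremes `0` and
`Ū`. Let `G` be the distribution function of `w` under `σ`, let `m = n - 1` be the number of rivals
and `π` the equilibrium profit. Deviations to full information at price `Ū - t` give `G(t)^m μ (Ū -
t) ≤ π` (`IsSymmetricEquilibrium.netCDF_pow_le`). Since `(W - p)(Ū - W) ≥ 0`, this implies `p G(W -
p)^m ≤ π W / (μ Ū)` (`acceptablePrice_mul_le`). The right side is linear in `W`, so its mean is `π`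
for every offer: no offer beats the fully revealing ones.

In equilibrium the bound is tight almost surely (`IsSymmetricEquilibrium.ae_eq`), which leaves `W =
0`, `w = 0` or `W = Ū`. Tightness also makes every firm win every tie, which is impossible when all
tie, so `w` has no atom at nonnegative values (`IsSymmetricEquilibrium.joint_netTruncated_eq`). This
removes `w = 0`, and `signal_eq_fullInformation` turns what is left into full revelation. The price
distribution `Φ` is then atomless, satisfies `p (1 - μ Φ(p))^m = π / μ` almost surely and `≤` for
all `p` in `(0, Ū]`; `real_Iic_eq_priceCDF` solves this for both `Φ` and `π`.

Conversely, with that `Φ` the bound on `G` holds for `π = μ (1 - μ)^m Ū`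
(`netCDF_equilibriumStrategy_le`), and almost every price drawn earns at least this much, so the
index rule completes an equilibrium. -/

/-! ### Signals and their reservation values -/

/-- The kernel that draws a posterior from the posted signal. -/
def signalKernel (μ : ℝ) : Kernel (Offer μ) ℝ where
  toFun a := signal a
  measurable' := measurable_subtype_coe.comp measurable_snd

variable {μ c : ℝ}

@[simp] lemma signalKernel_apply (a : Offer μ) : signalKernel μ a = signal a := rfl

instance isProbabilityMeasure_signal (a : Offer μ) : IsProbabilityMeasure (signal a) :=
  a.2.2.1

instance : IsMarkovKernel (signalKernel μ) := ⟨fun a => isProbabilityMeasure_signal a⟩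

lemma ae_mem_Icc_signal (a : Offer μ) : ∀ᵐ x ∂(signal a), x ∈ Set.Icc (0 : ℝ) 1 :=
  a.2.2.2.1

lemma integral_signal (a : Offer μ) : ∫ x, x ∂(signal a) = μ := a.2.2.2.2

lemma measurable_price : Measurable (price : Offer μ → ℝ) :=
  measurable_coe_nnreal_real.comp measurable_fst

lemma price_nonneg (a : Offer μ) : 0 ≤ price a := a.1.2

lemma integrable_of_abs_le {α : Type*} [MeasurableSpace α] {P : Measure α} [IsFiniteMeasure P]
    {f : α → ℝ} (hf : Measurable f) (C : ℝ) (h : ∀ᵐ x ∂P, |f x| ≤ C) : Integrable f P :=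
  Integrable.of_bound hf.aestronglyMeasurable C (by simpa using h)

lemma integrable_id_signal (a : Offer μ) : Integrable (fun x : ℝ => x) (signal a) :=
  integrable_of_abs_le measurable_id 1 (by
    filter_upwards [ae_mem_Icc_signal a] with x hx
    rw [abs_le]; exact ⟨by linarith [hx.1], hx.2⟩)

lemma integrable_excess (a : Offer μ) (t : ℝ) :
    Integrable (fun x : ℝ => max (x - t) 0) (signal a) :=
  ((integrable_id_signal a).sub (integrable_const t)).pos_part

/-- The expected excess of the posterior over `t`. -/
def excess (a : Offer μ) (t : ℝ) : ℝ := ∫ x, max (x - t) 0 ∂(signal a)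

lemma measurable_excess (t : ℝ) : Measurable fun a : Offer μ => excess a t := by
  have h : StronglyMeasurable fun x : ℝ => max (x - t) 0 :=
    ((measurable_id.sub_const t).max measurable_const).stronglyMeasurable
  exact (h.integral_kernel (κ := signalKernel μ)).measurable

lemma excess_antitone (a : Offer μ) : Antitone (excess a) := fun s t hst =>
  integral_mono (integrable_excess a t) (integrable_excess a s) fun x =>
    max_le_max (by linarith) le_rfl

lemma excess_le_add (a : Offer μ) {s t : ℝ} (hst : s ≤ t) : excess a s ≤ excess a t + (t - s) := by
  have h : ∫ x, (max (x - t) 0 + (t - s)) ∂(signal a) = excess a t + (t - s) := by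
    rw [integral_add (integrable_excess a t) (integrable_const _)]; simp [excess]
  rw [← h]
  refine integral_mono (integrable_excess a s)
    ((integrable_excess a t).add (integrable_const _)) fun x => ?_
  simp only
  rcases max_cases (x - s) 0 with ⟨h1, _⟩ | ⟨h1, _⟩ <;> rw [h1]
  · linarith [le_max_left (x - t) 0]
  · linarith [le_max_right (x - t) 0]

lemma continuous_excess (a : Offer μ) : Continuous (excess a) := by
  refine (LipschitzWith.of_le_add fun s t => ?_).continuous
  rcases le_total s t with h | h
  · have := excess_le_add a h
    rw [Real.dist_eq, abs_of_nonpos (by linarith)]; linarith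
  · exact (excess_antitone a h).trans (by linarith [dist_nonneg (x := s) (y := t)])

lemma excess_zero (a : Offer μ) : excess a 0 = μ := by
  refine Eq.trans (integral_congr_ae ?_) (integral_signal a)
  filter_upwards [ae_mem_Icc_signal a] with x hx
  simp [hx.1]

lemma excess_one (a : Offer μ) : excess a 1 = 0 := by
  rw [excess, ← integral_zero ℝ ℝ (μ := signal a)]
  refine integral_congr_ae ?_
  filter_upwards [ae_mem_Icc_signal a] with x hx
  simp [hx.2]

/-- The (gross) reservation value of an offer, at which the expected excess equals `c`. -/
def reservation (c : ℝ) (a : Offer μ) : ℝ := sSup {t | t ∈ Set.Icc (0 : ℝ) 1 ∧ c ≤ excess a t}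

/-- The supremum is attained because the set is closed and contains `0`, where the excess is `μ`.
For `c = 0` the equation for the reservation value has many solutions in general; the supremum
selects `1`, which is then also `Ū`. -/
lemma reservation_mem (hcμ : c ≤ μ) (a : Offer μ) :
    reservation c a ∈ {t | t ∈ Set.Icc (0 : ℝ) 1 ∧ c ≤ excess a t} := by
  refine IsClosed.csSup_mem ?_ ⟨0, ⟨by simp, by rwa [excess_zero]⟩⟩ ⟨1, fun t ht => ht.1.2⟩
  exact isClosed_Icc.inter (isClosed_le continuous_const (continuous_excess a))

lemma le_reservation {a : Offer μ} {t : ℝ} (ht : t ∈ Set.Icc (0 : ℝ) 1) (h : c ≤ excess a t) :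
    t ≤ reservation c a :=
  le_csSup ⟨1, fun _ hs => hs.1.2⟩ ⟨ht, h⟩

/-- The excess falls continuously from `μ` at `0` to `0` at `1`, so it takes the value `c` at some
point, which cannot lie beyond the supremum. -/
lemma excess_reservation (hc : 0 ≤ c) (hcμ : c ≤ μ) (a : Offer μ) :
    excess a (reservation c a) = c := by
  refine le_antisymm ?_ (reservation_mem hcμ a).2
  obtain ⟨t, ht, hte⟩ := intermediate_value_Icc' (zero_le_one (α := ℝ))
    (continuous_excess a).continuousOn (show c ∈ Set.Icc (excess a 1) (excess a 0) from
      ⟨by rwa [excess_one], by rwa [excess_zero]⟩)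
  rw [← hte]
  exact excess_antitone a (hte ▸ le_reservation ht hte.ge)

lemma measurable_reservation (hcμ : c ≤ μ) : Measurable (reservation c : Offer μ → ℝ) := by
  refine measurable_of_Ici fun t => ?_
  by_cases h0 : t ≤ 0
  · convert MeasurableSet.univ
    ext a
    simpa using h0.trans (reservation_mem hcμ a).1.1
  by_cases h1 : 1 < t
  · convert MeasurableSet.empty
    ext a
    simpa using (reservation_mem hcμ a).1.2.trans_lt h1
  have : reservation c ⁻¹' Set.Ici t = {a : Offer μ | c ≤ excess a t} := by
    ext a
    exact ⟨fun h => (reservation_mem hcμ a).2.trans (excess_antitone a h),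
      fun h => le_reservation ⟨by linarith, by linarith⟩ h⟩
  rw [this]
  exact measurableSet_le measurable_const (measurable_excess t)

lemma mul_maxReservation (hμ : 0 < μ) : μ * maxReservation μ c = μ - c := by
  rw [maxReservation]; field_simp

lemma maxReservation_pos (hμ : 0 < μ) (hcμ : c < μ) : 0 < maxReservation μ c :=
  div_pos (by linarith) hμ

lemma maxReservation_le_one (hμ : 0 < μ) (hc : 0 ≤ c) : maxReservation μ c ≤ 1 :=
  (div_le_one hμ).2 (by linarith)

/-- On `[0, 1]` the convex function `max (x - r) 0` lies below its chord `(1 - r) x`; integrating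
gives `c ≤ μ (1 - r)`. -/
lemma reservation_le (hμ : 0 < μ) (hc : 0 ≤ c) (hcμ : c ≤ μ) (a : Offer μ) :
    reservation c a ≤ maxReservation μ c := by
  have hr := (reservation_mem hcμ a).1
  have h : c ≤ μ * (1 - reservation c a) := by
    have e : ∫ x, (1 - reservation c a) * x ∂(signal a) = μ * (1 - reservation c a) := by
      rw [integral_const_mul, integral_signal, mul_comm]
    rw [← e]
    refine (excess_reservation hc hcμ a).ge.trans ?_
    refine integral_mono_ae (integrable_excess a _) ((integrable_id_signal a).const_mul _) ?_
    filter_upwards [ae_mem_Icc_signal a] with x hx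
    refine max_le ?_ (mul_nonneg (by linarith [hr.2]) hx.1)
    nlinarith [hx.1, hx.2, hr.1, hr.2]
  rw [maxReservation, le_div_iff₀ hμ]; linarith

/-- The posterior, truncated at the reservation value. -/
def truncated (c : ℝ) (z : Offer μ × ℝ) : ℝ := min z.2 (reservation c z.1)

lemma measurable_truncated (hcμ : c ≤ μ) : Measurable (truncated c : Offer μ × ℝ → ℝ) :=
  measurable_snd.min ((measurable_reservation hcμ).comp measurable_fst)

/-- The truncation removes exactly the excess over the reservation value, whose mean is `c`. This is
the only constraint on the law of `W`, besides its range, that the proof uses. -/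
lemma integral_truncated (hc : 0 ≤ c) (hcμ : c ≤ μ) (a : Offer μ) :
    ∫ x, truncated c (a, x) ∂(signal a) = μ - c := by
  have h : ∀ x : ℝ, truncated c (a, x) = x - max (x - reservation c a) 0 := fun x => by
    rcases le_total x (reservation c a) with h | h
    · simp [truncated, h]
    · simp [truncated, h]
  simp_rw [h]
  rw [integral_sub (integrable_id_signal a) (integrable_excess a _), integral_signal]
  exact congrArg _ (excess_reservation hc hcμ a)

lemma truncated_nonneg (hcμ : c ≤ μ) (a : Offer μ) :
    ∀ᵐ x ∂(signal a), 0 ≤ truncated c (a, x) := by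
  filter_upwards [ae_mem_Icc_signal a] with x hx
  exact le_min hx.1 (reservation_mem hcμ a).1.1

lemma truncated_le (hμ : 0 < μ) (hc : 0 ≤ c) (hcμ : c ≤ μ) (z : Offer μ × ℝ) :
    truncated c z ≤ maxReservation μ c :=
  (min_le_right _ _).trans (reservation_le hμ hc hcμ z.1)

lemma isProbabilityMeasure_fullInformation (h0 : 0 ≤ μ) (h1 : μ ≤ 1) :
    IsProbabilityMeasure (fullInformation μ) := by
  constructor
  rw [fullInformation]
  simp only [Measure.add_apply, Measure.smul_apply, measure_univ, smul_eq_mul, mul_one]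
  rw [← ENNReal.ofReal_add (by linarith) h0]
  simp

lemma integral_fullInformation (h0 : 0 ≤ μ) (h1 : μ ≤ 1) (f : ℝ → ℝ) :
    ∫ x, f x ∂(fullInformation μ) = (1 - μ) * f 0 + μ * f 1 := by
  rw [fullInformation, integral_add_measure, integral_smul_measure, integral_smul_measure]
  · simp [ENNReal.toReal_ofReal, h0, h1]
  · exact (integrable_dirac (by simp)).smul_measure (by simp)
  · exact (integrable_dirac (by simp)).smul_measure (by simp)

lemma isBayesPlausible_fullInformation (h0 : 0 ≤ μ) (h1 : μ ≤ 1) :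
    IsBayesPlausible μ (fullInformation μ) := by
  refine ⟨isProbabilityMeasure_fullInformation h0 h1, ?_, ?_⟩
  · simp [fullInformation, isClosed_Icc.measurableSet]
  · rw [integral_fullInformation h0 h1]; simp

/-- Full information, at the price `p`. -/
def fullOffer (h0 : 0 ≤ μ) (h1 : μ ≤ 1) (p : ℝ≥0) : Offer μ :=
  (p, ⟨fullInformation μ, isBayesPlausible_fullInformation h0 h1⟩)

/-- A Bayes-plausible distribution all of whose mass is at zero and at posteriors where the
truncation attains the highest value is fully revealing. -/
lemma signal_eq_fullInformation (hμ : 0 < μ) (hc : 0 ≤ c) (hcμ : c < μ)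
    (a : Offer μ) (h : ∀ᵐ x ∂(signal a), truncated c (a, x) = 0 ∨
      truncated c (a, x) = maxReservation μ c) : signal a = fullInformation μ := by
  have hU := maxReservation_pos hμ hcμ
  have hr0 : 0 < reservation c a := by
    by_contra hr
    have hz : ∫ x, truncated c (a, x) ∂(signal a) ≤ 0 :=
      integral_nonpos_of_ae (Filter.Eventually.of_forall fun x =>
        (min_le_right _ _).trans (not_lt.1 hr))
    rw [integral_truncated hc hcμ.le] at hz
    linarith
  have h' : ∀ᵐ x ∂(signal a), x ∈ Set.Icc (0 : ℝ) 1 ∧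
      truncated c (a, x) = maxReservation μ c * Set.indicator (Set.Ioi (0 : ℝ)) 1 x := by
    filter_upwards [h, ae_mem_Icc_signal a] with x hx hx1
    refine ⟨hx1, ?_⟩
    rcases hx1.1.eq_or_lt with h0 | h0
    · subst h0; simp [truncated, hr0.le]
    · have : 0 < truncated c (a, x) := lt_min h0 hr0
      rcases hx with hx | hx
      · linarith
      · simp [hx, h0]
  -- The truncation is `Ū` times the indicator of a positive posterior, and its mean is `μ Ū`.
  have hm : (signal a).real (Set.Ioi 0) = μ := by
    have e := integral_truncated hc hcμ.le a
    rw [integral_congr_ae (h'.mono fun x hx => hx.2), integral_const_mul,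
      integral_indicator_one measurableSet_Ioi, ← mul_maxReservation hμ, mul_comm μ] at e
    exact mul_left_cancel₀ hU.ne' e
  -- On `[0, 1]` the indicator dominates `x`, and both have mean `μ`, so they agree almost surely.
  have hx1 : ∀ᵐ x ∂(signal a), Set.indicator (Set.Ioi (0 : ℝ)) 1 x - x = 0 := by
    refine (integral_eq_zero_iff_of_nonneg_ae ?_ ?_).1 ?_
    · filter_upwards [ae_mem_Icc_signal a] with x hx
      rcases hx.1.eq_or_lt with h0 | h0
      · subst h0; simp
      · simp [h0, hx.2]
    · exact ((integrable_const (1 : ℝ)).indicator measurableSet_Ioi).sub (integrable_id_signal a)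
    · have e := integral_sub ((integrable_const (1 : ℝ)).indicator
        (measurableSet_Ioi (a := (0 : ℝ)))) (integrable_id_signal a)
      have := integral_indicator_one (μ := signal a) (measurableSet_Ioi (a := (0 : ℝ)))
      rw [hm] at this
      refine e.trans ?_
      rw [integral_signal]
      exact sub_eq_zero.2 this
  have h01 : ∀ᵐ x ∂(signal a), x = 0 ∨ x = 1 := by
    filter_upwards [hx1, ae_mem_Icc_signal a] with x hx hx1
    rcases hx1.1.eq_or_lt with h0 | h0
    · exact Or.inl h0.symm
    · right; simp [h0] at hx; linarith
  have hone : signal a {1} = ENNReal.ofReal μ := by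
    refine Eq.trans (measure_congr ?_) (ENNReal.ofReal_toReal
      (measure_ne_top (signal a) (Set.Ioi 0))).symm |>.trans (congrArg _ hm)
    filter_upwards [h01] with x hx
    refine propext ?_
    change x = 1 ↔ 0 < x
    rcases hx with rfl | rfl <;> simp
  have hzero : signal a {0} = ENNReal.ofReal (1 - μ) := by
    have : signal a {0} = signal a {1}ᶜ := by
      refine measure_congr ?_
      filter_upwards [h01] with x hx
      refine propext ?_
      change x = 0 ↔ ¬ x = 1
      rcases hx with rfl | rfl <;> simp
    rw [this, prob_compl_eq_one_sub (measurableSet_singleton _), hone,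
      ENNReal.ofReal_sub _ hμ.le, ENNReal.ofReal_one]
  ext s hs
  have hs' : signal a s = signal a (s ∩ {0}) + signal a (s ∩ {1}) := by
    rw [← measure_union (by
      rw [Set.disjoint_left]; rintro x ⟨_, hx⟩ ⟨_, hx'⟩
      simp only [Set.mem_singleton_iff] at hx hx'; linarith)
      (hs.inter (measurableSet_singleton _))]
    refine measure_congr ?_
    filter_upwards [h01] with x hx
    refine propext ?_
    change x ∈ s ↔ (x ∈ s ∧ x = 0) ∨ (x ∈ s ∧ x = 1)
    tauto
  rw [hs', fullInformation]
  simp only [Measure.add_apply, Measure.smul_apply, smul_eq_mul, Measure.dirac_apply' _ hs]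
  congr 1
  · by_cases h0 : (0 : ℝ) ∈ s
    · rw [Set.inter_eq_right.2 (by simpa using h0), hzero]; simp [h0]
    · rw [Set.inter_singleton_eq_empty.2 h0]; simp [h0]
  · by_cases h0 : (1 : ℝ) ∈ s
    · rw [Set.inter_eq_right.2 (by simpa using h0), hone]; simp [h0]
    · rw [Set.inter_singleton_eq_empty.2 h0]; simp [h0]

lemma reservation_fullInformation (hμ : 0 < μ) (hc : 0 ≤ c) (hcμ : c ≤ μ) (hμ1 : μ ≤ 1)
    {a : Offer μ} (ha : signal a = fullInformation μ) :
    reservation c a = maxReservation μ c := by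
  refine le_antisymm (reservation_le hμ hc hcμ a) (le_reservation
    ⟨div_nonneg (by linarith) hμ.le, maxReservation_le_one hμ hc⟩ ?_)
  rw [excess, ha, integral_fullInformation hμ.le hμ1]
  have h1 := maxReservation_le_one (c := c) hμ hc
  have h2 : 0 ≤ maxReservation μ c := div_nonneg (by linarith) hμ.le
  rw [max_eq_right (by linarith), max_eq_left (by linarith), mul_sub, mul_maxReservation hμ]
  simp

/-! ### The search problem of the consumer -/

section Search

variable {n : ℕ}

lemma sum_purchaseProb_zero (δ : SearchPlan n) (z : Fin n → ℝ) (l : List (Fin n))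
    (v : Fin n → ℝ) :
    ∑ i, purchaseProb δ z 0 l i * v i = ∑ i, if i ∈ l then δ l z (some i) * v i else 0 :=
  Finset.sum_congr rfl fun i _ => by by_cases h : i ∈ l <;> simp [purchaseProb, h]

lemma sum_purchaseProb_succ (δ : SearchPlan n) (z : Fin n → ℝ) (k : ℕ) (l : List (Fin n))
    (v : Fin n → ℝ) :
    ∑ i, purchaseProb δ z (k + 1) l i * v i =
      (∑ i, if i ∈ l then δ l z (some i) * v i else 0) +
      ∑ j, if j ∈ l then 0 else
        δ l z (some j) * ∑ i, purchaseProb δ z k (j :: l) i * v i := by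
  simp only [purchaseProb, add_mul, Finset.sum_add_distrib]
  congr 1
  · exact Finset.sum_congr rfl fun i _ => by by_cases h : i ∈ l <;> simp [h]
  · simp only [Finset.sum_mul]
    rw [Finset.sum_comm]
    refine Finset.sum_congr rfl fun j _ => ?_
    by_cases h : j ∈ l
    · simp [h]
    · simp [h, Finset.mul_sum, mul_assoc]

lemma sum_some_le_one {δ : SearchPlan n} (hδ : IsSearchPlan δ) (l : List (Fin n))
    (z : Fin n → ℝ) : ∑ j, δ l z (some j) ≤ 1 := by
  have := hδ.sum_eq_one l z
  rw [Fintype.sum_option] at this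
  linarith [hδ.nonneg l z none]

lemma purchaseProb_nonneg {δ : SearchPlan n} (hδ : IsSearchPlan δ) (z : Fin n → ℝ) (k : ℕ)
    (l : List (Fin n)) (i : Fin n) : 0 ≤ purchaseProb δ z k l i := by
  induction k generalizing l with
  | zero => rw [purchaseProb]; split_ifs; exacts [hδ.nonneg _ _ _, le_rfl]
  | succ k ih =>
    rw [purchaseProb]
    refine add_nonneg (by split_ifs; exacts [hδ.nonneg _ _ _, le_rfl])
      (Finset.sum_nonneg fun j _ => ?_)
    split_ifs
    exacts [le_rfl, mul_nonneg (hδ.nonneg _ _ _) (ih _)]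

lemma sum_purchaseProb_le_one {δ : SearchPlan n} (hδ : IsSearchPlan δ) (z : Fin n → ℝ) (k : ℕ)
    (l : List (Fin n)) : ∑ i, purchaseProb δ z k l i ≤ 1 := by
  induction k generalizing l with
  | zero =>
    have := sum_purchaseProb_zero δ z l 1
    simp only [Pi.one_apply, mul_one] at this
    rw [this]
    refine (Finset.sum_le_sum fun j _ => ?_).trans (sum_some_le_one hδ l z)
    split_ifs
    exacts [le_rfl, hδ.nonneg _ _ _]
  | succ k ih =>
    have := sum_purchaseProb_succ δ z k l 1
    simp only [Pi.one_apply, mul_one] at this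
    rw [this, ← Finset.sum_add_distrib]
    refine (Finset.sum_le_sum fun j _ => ?_).trans (sum_some_le_one hδ l z)
    split_ifs
    · simp
    · simpa using mul_le_of_le_one_right (hδ.nonneg l z (some j)) (ih (j :: l))

lemma purchaseProb_le_one {δ : SearchPlan n} (hδ : IsSearchPlan δ) (z : Fin n → ℝ) (k : ℕ)
    (l : List (Fin n)) (i : Fin n) : purchaseProb δ z k l i ≤ 1 :=
  (Finset.single_le_sum (fun j _ => purchaseProb_nonneg hδ z k l j)
    (Finset.mem_univ i)).trans (sum_purchaseProb_le_one hδ z k l)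

section Measurability

variable {α : Type*} [MeasurableSpace α] {δ : α → SearchPlan n} {z : α → Fin n → ℝ}

lemma measurable_purchaseProb (hδ : ∀ l a, Measurable fun t => δ t l (z t) a) (k : ℕ)
    (l : List (Fin n)) (i : Fin n) : Measurable fun t => purchaseProb (δ t) (z t) k l i := by
  induction k generalizing l with
  | zero =>
    simp only [purchaseProb]
    split_ifs
    exacts [hδ _ _, measurable_const]
  | succ k ih =>
    simp only [purchaseProb]
    refine Measurable.add (by split_ifs; exacts [hδ _ _, measurable_const])
      (Finset.measurable_sum _ fun j _ => ?_)
    split_ifs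
    exacts [measurable_const, (hδ _ _).mul (ih _)]

lemma measurable_expectedVisits (hδ : ∀ l a, Measurable fun t => δ t l (z t) a) (k : ℕ)
    (l : List (Fin n)) : Measurable fun t => expectedVisits (δ t) (z t) k l := by
  induction k generalizing l with
  | zero => exact measurable_const
  | succ k ih =>
    simp only [expectedVisits]
    refine Finset.measurable_sum _ fun j _ => ?_
    split_ifs
    exacts [measurable_const, (hδ _ _).mul (measurable_const.add (ih _))]

end Measurability

/-- The payoff of the consumer from the history `l` on, when the posteriors are `z`. -/
def payoff (c : ℝ) (p : Fin n → ℝ) (δ : SearchPlan n) (k : ℕ) (l : List (Fin n))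
    (z : Fin n → ℝ) : ℝ :=
  ∑ i, purchaseProb δ z k l i * (z i - p i) - c * expectedVisits δ z k l

/-- The value of an option, where the posteriors of unvisited firms are truncated at their
reservation values. -/
def netValue (p r : Fin n → ℝ) (l : List (Fin n)) (z : Fin n → ℝ) : Option (Fin n) → ℝ
  | none => 0
  | some i => (if i ∈ l then z i else min (z i) (r i)) - p i

/-- The Weitzman index of an option. -/
def searchIndex (p r : Fin n → ℝ) (l : List (Fin n)) (z : Fin n → ℝ) : Option (Fin n) → ℝ
  | none => 0
  | some i => (if i ∈ l then z i else r i) - p i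

/-- The part of the payoff that comes from the deviations of the excess of visited firms over
their reservation values from its mean. -/
def drift (c : ℝ) (r : Fin n → ℝ) (δ : SearchPlan n) (z : Fin n → ℝ) :
    ℕ → List (Fin n) → ℝ
  | 0, _ => 0
  | k + 1, l => ∑ j, if j ∈ l then 0 else
      δ l z (some j) * (drift c r δ z k (j :: l) + (max (z j - r j) 0 - c))

/-- The loss from not buying from a visited firm whose posterior exceeds its reservation value. -/
def loss (r : Fin n → ℝ) (δ : SearchPlan n) (z : Fin n → ℝ) : ℕ → List (Fin n) → ℝ
  | 0, _ => 0
  | k + 1, l => ∑ j, if j ∈ l then 0 else δ l z (some j) *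
      (loss r δ z k (j :: l) + (1 - purchaseProb δ z k (j :: l) j) * max (z j - r j) 0)

/-- A visit lifts the truncation of the visited firm and changes nothing else. -/
lemma netValue_cons (p r : Fin n → ℝ) {l : List (Fin n)} {j : Fin n} (hj : j ∉ l)
    (z : Fin n → ℝ) (i : Fin n) :
    netValue p r l z (some i) = netValue p r (j :: l) z (some i)
      - if i = j then max (z j - r j) 0 else 0 := by
  by_cases h : i = j
  · subst h
    rcases le_total (z i) (r i) with h | h <;> simp [netValue, hj, h]
  · simp [netValue, h]

lemma sum_purchaseProb_netValue_cons (p r : Fin n → ℝ) (δ : SearchPlan n) {l : List (Fin n)}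
    {j : Fin n} (hj : j ∉ l) (z : Fin n → ℝ) (k : ℕ) (l' : List (Fin n)) :
    ∑ i, purchaseProb δ z k l' i * netValue p r l z (some i) =
      ∑ i, purchaseProb δ z k l' i * netValue p r (j :: l) z (some i) -
        purchaseProb δ z k l' j * max (z j - r j) 0 := by
  simp only [netValue_cons p r hj, mul_sub, Finset.sum_sub_distrib]
  simp

/-- A pathwise identity, free of optimality and probability. A visit to `j` costs `c` and yields the
excess over `r j` only if `j` is bought in the end. Book the full excess minus `c` as drift, and the
excess that is not collected as loss; induction on the remaining visits adds up the entries. -/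
theorem payoff_eq (c : ℝ) (p r : Fin n → ℝ) (δ : SearchPlan n) (k : ℕ) (l : List (Fin n))
    (z : Fin n → ℝ) : payoff c p δ k l z =
      ∑ i, purchaseProb δ z k l i * netValue p r l z (some i) - loss r δ z k l
        + drift c r δ z k l := by
  have hv : ∀ l : List (Fin n), (∑ i, if i ∈ l then δ l z (some i) * (z i - p i) else 0) =
      ∑ i, if i ∈ l then δ l z (some i) * netValue p r l z (some i) else 0 := fun l =>
    Finset.sum_congr rfl fun i _ => by by_cases h : i ∈ l <;> simp [netValue, h]
  induction k generalizing l with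
  | zero =>
    simp [payoff, sum_purchaseProb_zero, loss, drift, expectedVisits, hv]
  | succ k ih =>
    rw [payoff, sum_purchaseProb_succ, sum_purchaseProb_succ, hv]
    simp only [loss, drift, expectedVisits]
    rw [Finset.mul_sum _ _ c, add_sub_assoc, add_sub_assoc, add_assoc, ← Finset.sum_sub_distrib,
      ← Finset.sum_sub_distrib, ← Finset.sum_add_distrib,
      ← Finset.sum_add_distrib, ← Finset.sum_add_distrib]
    refine Finset.sum_congr rfl fun j _ => ?_
    by_cases hj : j ∈ l
    · simp [hj]
    · simp only [hj, if_false]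
      have := ih (j :: l)
      rw [payoff] at this
      rw [sum_purchaseProb_netValue_cons p r δ hj]
      linear_combination δ l z (some j) * this

lemma loss_nonneg {δ : SearchPlan n} (hδ : IsSearchPlan δ) (r : Fin n → ℝ) (z : Fin n → ℝ)
    (k : ℕ) (l : List (Fin n)) : 0 ≤ loss r δ z k l := by
  induction k generalizing l with
  | zero => exact le_rfl
  | succ k ih =>
    rw [loss]
    refine Finset.sum_nonneg fun j _ => ?_
    split_ifs
    · exact le_rfl
    · exact mul_nonneg (hδ.nonneg _ _ _) (add_nonneg (ih _) (mul_nonneg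
        (sub_nonneg.2 (purchaseProb_le_one hδ _ _ _ _)) (le_max_right _ _)))

lemma measurable_drift {δ : SearchPlan n} (hδ : IsSearchPlan δ) (c : ℝ) (r : Fin n → ℝ) (k : ℕ)
    (l : List (Fin n)) : Measurable fun z => drift c r δ z k l := by
  induction k generalizing l with
  | zero => exact measurable_const
  | succ k ih =>
    simp only [drift]
    refine Finset.measurable_sum _ fun j _ => ?_
    split_ifs
    · exact measurable_const
    · exact (hδ.measurable _ _).mul ((ih _).add
        ((((measurable_pi_apply j).sub_const _).max measurable_const).sub_const _))

lemma measurable_payoff {δ : SearchPlan n} (hδ : IsSearchPlan δ) (c : ℝ) (p : Fin n → ℝ) (k : ℕ)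
    (l : List (Fin n)) : Measurable fun z => payoff c p δ k l z :=
  (Finset.measurable_sum _ fun i _ =>
    (measurable_purchaseProb (fun l a => hδ.measurable l a) k l i).mul
      ((measurable_pi_apply i).sub_const _)).sub
    ((measurable_expectedVisits (fun l a => hδ.measurable l a) k l).const_mul c)

lemma le_one_of_isSearchPlan {δ : SearchPlan n} (hδ : IsSearchPlan δ) (l : List (Fin n))
    (z : Fin n → ℝ) (a : Option (Fin n)) : δ l z a ≤ 1 :=
  (Finset.single_le_sum (fun b _ => hδ.nonneg l z b) (Finset.mem_univ a)).trans
    (hδ.sum_eq_one l z).le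

lemma exists_abs_drift_le {δ : SearchPlan n} (hδ : IsSearchPlan δ) (c : ℝ) (r : Fin n → ℝ)
    (k : ℕ) (l : List (Fin n)) :
    ∃ C, ∀ z : Fin n → ℝ, (∀ j, z j ∈ Set.Icc (0 : ℝ) 1) → |drift c r δ z k l| ≤ C := by
  induction k generalizing l with
  | zero => exact ⟨0, fun z _ => by simp [drift]⟩
  | succ k ih =>
    choose C hC using fun j => ih (j :: l)
    refine ⟨∑ j, (|C j| + (1 + |r j| + |c|)), fun z hz => ?_⟩
    rw [drift]
    refine (Finset.abs_sum_le_sum_abs _ _).trans (Finset.sum_le_sum fun j _ => ?_)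
    split_ifs
    · rw [abs_zero]; positivity
    · rw [abs_mul, abs_of_nonneg (hδ.nonneg _ _ _)]
      refine (mul_le_of_le_one_left (abs_nonneg _) (le_one_of_isSearchPlan hδ _ _ _)).trans ?_
      refine (abs_add_le _ _).trans (add_le_add ((hC j z hz).trans (le_abs_self _)) ?_)
      refine (abs_sub _ _).trans (add_le_add ?_ le_rfl)
      rw [abs_of_nonneg (le_max_right _ _)]
      refine max_le ?_ (by positivity)
      linarith [(hz j).2, neg_abs_le (r j)]

variable {G : Fin n → Measure ℝ} [∀ j, IsProbabilityMeasure (G j)]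

/-- Coordinate `j` is independent of the others, so the integral factors. -/
lemma integral_pi_mul_eq_zero {j : Fin n} {g : (Fin n → ℝ) → ℝ} {h : ℝ → ℝ}
    (hg : ∀ z z' : Fin n → ℝ, (∀ i, i ≠ j → z i = z' i) → g z = g z')
    (hh : ∫ x, h x ∂(G j) = 0) : ∫ z, g z * h (z j) ∂(Measure.pi G) = 0 := by
  cases n with
  | zero => exact j.elim0
  | succ m =>
    have e := (measurePreserving_piFinSuccAbove G j).integral_comp'
      -- The `0` put at coordinate `j` is a dummy, since `g` ignores that coordinate.
      (fun q => h q.1 * g (j.insertNth 0 q.2))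
    rw [integral_prod_mul (f := h) (g := fun q => g (j.insertNth 0 q)), hh, zero_mul] at e
    rw [← e]
    refine integral_congr_ae (Filter.Eventually.of_forall fun z => ?_)
    simp only [MeasurableEquiv.piFinSuccAbove_apply, Fin.insertNthEquiv_symm_apply]
    rw [mul_comm, hg z (j.insertNth 0 (j.removeNth z))]
    intro i hi
    obtain ⟨i, rfl⟩ := Fin.exists_succAbove_eq hi
    simp [Fin.removeNth]

lemma ae_pi_mem_Icc (hG : ∀ j, ∀ᵐ x ∂(G j), x ∈ Set.Icc (0 : ℝ) 1) :
    ∀ᵐ z ∂(Measure.pi G), ∀ j, z j ∈ Set.Icc (0 : ℝ) 1 :=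
  ae_all_iff.2 fun j => (measurePreserving_eval G j).quasiMeasurePreserving.ae (hG j)

/-- The martingale property: the decision to visit `j` uses only posteriors already seen, hence is
independent of the posterior of `j`, whose excess minus `c` has mean zero. The weight `φ` stands for
the probability of having reached the history; the induction replaces it by `φ` times the
probability of the next visit. -/
lemma integral_mul_drift (hG : ∀ j, ∀ᵐ x ∂(G j), x ∈ Set.Icc (0 : ℝ) 1) {δ : SearchPlan n}
    (hδ : IsSearchPlan δ) {c : ℝ} {r : Fin n → ℝ} (k : ℕ) (l : List (Fin n))
    (hr : ∀ j, j ∉ l → ∫ x, max (x - r j) 0 ∂(G j) = c) {φ : (Fin n → ℝ) → ℝ}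
    (hφ : Measurable φ) (hφ0 : ∀ z, 0 ≤ φ z) (hφ1 : ∀ z, φ z ≤ 1)
    (hφl : ∀ z z' : Fin n → ℝ, (∀ i ∈ l, z i = z' i) → φ z = φ z') :
    ∫ z, φ z * drift c r δ z k l ∂(Measure.pi G) = 0 := by
  induction k generalizing l φ with
  | zero => simp [drift]
  | succ k ih =>
    have hb : ∀ (ψ : (Fin n → ℝ) → ℝ), Measurable ψ → (∀ z, 0 ≤ ψ z) → (∀ z, ψ z ≤ 1) →
        ∀ l, Integrable (fun z => ψ z * drift c r δ z k l) (Measure.pi G) := by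
      intro ψ hψ hψ0 hψ1 l
      obtain ⟨C, hC⟩ := exists_abs_drift_le hδ c r k l
      refine integrable_of_abs_le (hψ.mul (measurable_drift hδ c r k l)) C ?_
      filter_upwards [ae_pi_mem_Icc hG] with z hz
      rw [abs_mul, abs_of_nonneg (hψ0 z)]
      exact (mul_le_of_le_one_left (abs_nonneg _) (hψ1 z)).trans (hC z hz)
    have hm : ∀ j, Measurable fun z : Fin n → ℝ => max (z j - r j) 0 - c := fun j =>
      (((measurable_pi_apply j).sub_const _).max measurable_const).sub_const _
    have hb' : ∀ (ψ : (Fin n → ℝ) → ℝ), Measurable ψ → (∀ z, 0 ≤ ψ z) → (∀ z, ψ z ≤ 1) →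
        ∀ j, Integrable (fun z => ψ z * (max (z j - r j) 0 - c)) (Measure.pi G) := by
      intro ψ hψ hψ0 hψ1 j
      refine integrable_of_abs_le (hψ.mul (hm j)) (1 + |r j| + |c|) ?_
      filter_upwards [ae_pi_mem_Icc hG] with z hz
      rw [abs_mul, abs_of_nonneg (hψ0 z)]
      refine (mul_le_of_le_one_left (abs_nonneg _) (hψ1 z)).trans ?_
      refine (abs_sub _ _).trans (add_le_add ?_ le_rfl)
      rw [abs_of_nonneg (le_max_right _ _)]
      refine max_le ?_ (by positivity)
      linarith [(hz j).2, neg_abs_le (r j)]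
    have hφδ : ∀ j, Measurable fun z => φ z * δ l z (some j) := fun j =>
      hφ.mul (hδ.measurable _ _)
    have hφδ0 : ∀ j z, 0 ≤ φ z * δ l z (some j) := fun j z =>
      mul_nonneg (hφ0 z) (hδ.nonneg _ _ _)
    have hφδ1 : ∀ j z, φ z * δ l z (some j) ≤ 1 := fun j z =>
      mul_le_one₀ (hφ1 z) (hδ.nonneg _ _ _) (le_one_of_isSearchPlan hδ _ _ _)
    have hφδl : ∀ j, ∀ z z' : Fin n → ℝ, (∀ i ∈ l, z i = z' i) →
        φ z * δ l z (some j) = φ z' * δ l z' (some j) := fun j z z' h => by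
      rw [hφl z z' h, hδ.nonanticipating l z z' h]
    have hterm : ∀ j, (fun z => φ z * if j ∈ l then 0 else
        δ l z (some j) * (drift c r δ z k (j :: l) + (max (z j - r j) 0 - c))) =
        if j ∈ l then 0 else fun z => φ z * δ l z (some j) * drift c r δ z k (j :: l) +
          φ z * δ l z (some j) * (max (z j - r j) 0 - c) := fun j => by
      by_cases hj : j ∈ l
      · simp only [hj, if_true, mul_zero]; rfl
      · simp only [hj, if_false]; funext z; ring
    simp only [drift, Finset.mul_sum]
    rw [integral_finsetSum]
    · refine Finset.sum_eq_zero fun j _ => ?_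
      rw [hterm]
      by_cases hj : j ∈ l
      · simp [hj]
      · simp only [hj, if_false]
        rw [integral_add (hb _ (hφδ j) (hφδ0 j) (hφδ1 j) _)
          (hb' _ (hφδ j) (hφδ0 j) (hφδ1 j) j),
          ih (j :: l) (fun i hi => hr i fun h => hi (List.mem_cons_of_mem _ h)) (hφδ j) (hφδ0 j)
            (hφδ1 j) (fun z z' h => hφδl j z z' fun i hi => h i (List.mem_cons_of_mem _ hi)),
          integral_pi_mul_eq_zero (j := j) (g := fun z => φ z * δ l z (some j))
            (h := fun x => max (x - r j) 0 - c), add_zero]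
        · exact fun z z' h => hφδl j z z' fun i hi => h i fun e => hj (e ▸ hi)
        · rw [integral_sub, hr j hj]
          · simp
          · refine integrable_of_abs_le ((measurable_id.sub_const _).max measurable_const)
              (1 + |r j|) ?_
            filter_upwards [hG j] with x hx
            rw [abs_of_nonneg (le_max_right _ _)]
            refine max_le ?_ (by positivity)
            linarith [hx.2, neg_abs_le (r j)]
          · exact integrable_const _
    · intro j _
      rw [hterm]
      by_cases hj : j ∈ l
      · simp [hj]
      · simp only [hj, if_false]
        exact (hb _ (hφδ j) (hφδ0 j) (hφδ1 j) _).add (hb' _ (hφδ j) (hφδ0 j) (hφδ1 j) j)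

end Search

/-! ### Optimality of the index rule -/

section Index

variable {n : ℕ}

open Classical in
/-- The plan that always chooses (uniformly) one of the options with the highest index. -/
def indexPlan (p r : Fin n → ℝ) : SearchPlan n := fun l z a =>
  (if ∀ b, searchIndex p r l z b ≤ searchIndex p r l z a then 1 else 0) /
    ∑ a', if ∀ b, searchIndex p r l z b ≤ searchIndex p r l z a' then 1 else 0

variable {p r : Fin n → ℝ}

open Classical in
lemma sum_best_pos (p r : Fin n → ℝ) (l : List (Fin n)) (z : Fin n → ℝ) :
    (0 : ℝ) < ∑ a, if ∀ b, searchIndex p r l z b ≤ searchIndex p r l z a then 1 else 0 := by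
  obtain ⟨a, ha⟩ := Finite.exists_max (searchIndex p r l z)
  refine Finset.sum_pos' (fun b _ => by split_ifs <;> simp) ⟨a, Finset.mem_univ _, ?_⟩
  rw [if_pos ha]; exact one_pos

lemma le_searchIndex_of_indexPlan_ne_zero {l : List (Fin n)} {z : Fin n → ℝ}
    {a : Option (Fin n)} (h : indexPlan p r l z a ≠ 0) (b : Option (Fin n)) :
    searchIndex p r l z b ≤ searchIndex p r l z a := by
  by_contra hb
  refine h ?_
  rw [indexPlan, if_neg (fun h => hb (h b)), zero_div]

lemma searchIndex_congr {l : List (Fin n)} {z z' : Fin n → ℝ} (h : ∀ j ∈ l, z j = z' j) :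
    searchIndex p r l z = searchIndex p r l z' := by
  funext a
  cases a with
  | none => rfl
  | some j => by_cases hj : j ∈ l <;> simp [searchIndex, hj, h]

/-- Prices and reservation values vary along with the posteriors because a consumer strategy must be
jointly measurable in offers and posteriors. -/
lemma measurable_indexPlan {α : Type*} [MeasurableSpace α] {p r z : α → Fin n → ℝ}
    (hp : ∀ j, Measurable fun t => p t j) (hr : ∀ j, Measurable fun t => r t j)
    (hz : ∀ j, Measurable fun t => z t j) (l : List (Fin n)) (a : Option (Fin n)) :
    Measurable fun t => indexPlan (p t) (r t) l (z t) a := by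
  classical
  have hi : ∀ a, Measurable fun t => searchIndex (p t) (r t) l (z t) a := by
    intro a
    cases a with
    | none => exact measurable_const
    | some j =>
      by_cases hj : j ∈ l
      · simp only [searchIndex, hj, if_true]; exact (hz j).sub (hp j)
      · simp only [searchIndex, hj, if_false]; exact (hr j).sub (hp j)
  have hb : ∀ a, Measurable fun t => if ∀ b, searchIndex (p t) (r t) l (z t) b ≤
      searchIndex (p t) (r t) l (z t) a then (1 : ℝ) else 0 := fun a =>
    Measurable.ite (by
      simp only [Set.ofPred_forall]
      exact MeasurableSet.iInter fun b => measurableSet_le (hi b) (hi a))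
      measurable_const measurable_const
  have := (hb a).div (Finset.measurable_sum Finset.univ fun a _ => hb a)
  convert this using 1
  funext t
  simp [indexPlan]

lemma isSearchPlan_indexPlan (p r : Fin n → ℝ) : IsSearchPlan (indexPlan p r) where
  nonneg l z a := div_nonneg (by split_ifs <;> simp) (sum_best_pos p r l z).le
  sum_eq_one l z := by
    simp only [indexPlan]
    rw [← Finset.sum_div, div_self (sum_best_pos p r l z).ne']
  nonanticipating l z z' h := by
    funext a
    simp only [indexPlan, searchIndex_congr h]
  measurable l a := measurable_indexPlan (p := fun _ => p) (r := fun _ => r)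
    (fun _ => measurable_const) (fun _ => measurable_const) measurable_pi_apply l a

lemma indexPlan_eq_one {l : List (Fin n)} {z : Fin n → ℝ} {a : Option (Fin n)}
    (h : ∀ b, b ≠ a → searchIndex p r l z b < searchIndex p r l z a) :
    indexPlan p r l z a = 1 := by
  rw [← (isSearchPlan_indexPlan p r).sum_eq_one l z]
  refine (Finset.sum_eq_single a (fun b _ hb => ?_) (by simp)).symm
  by_contra h0
  exact (h b hb).not_ge (le_searchIndex_of_indexPlan_ne_zero h0 a)

lemma purchaseProb_eq_one {δ : SearchPlan n} (hδ : IsSearchPlan δ) {z : Fin n → ℝ}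
    {l : List (Fin n)} {j : Fin n} (hj : j ∈ l) (h : δ l z (some j) = 1) (k : ℕ) :
    purchaseProb δ z k l j = 1 := by
  refine le_antisymm (purchaseProb_le_one hδ z k l j) ?_
  cases k with
  | zero => simp [purchaseProb, hj, h]
  | succ k =>
    rw [purchaseProb, if_pos hj, h]
    refine le_add_of_nonneg_right (Finset.sum_nonneg fun i _ => ?_)
    split_ifs
    exacts [le_rfl, mul_nonneg (hδ.nonneg _ _ _) (purchaseProb_nonneg hδ _ _ _ _)]

lemma netValue_le_searchIndex (l : List (Fin n)) (z : Fin n → ℝ) (a : Option (Fin n)) :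
    netValue p r l z a ≤ searchIndex p r l z a := by
  cases a with
  | none => exact le_rfl
  | some j => by_cases hj : j ∈ l <;> simp [netValue, searchIndex, hj]

/-- When `j` was chosen its index was highest. The visit raises that index strictly and leaves the
others alone, so `j` is bought at once. This is why the index rule has no loss. -/
lemma purchaseProb_indexPlan_of_excess {l : List (Fin n)} {z : Fin n → ℝ} {j : Fin n}
    (hj : j ∉ l) (h : indexPlan p r l z (some j) ≠ 0) (hz : r j < z j) (k : ℕ) :
    purchaseProb (indexPlan p r) z k (j :: l) j = 1 := by
  refine purchaseProb_eq_one (isSearchPlan_indexPlan p r) List.mem_cons_self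
    (indexPlan_eq_one fun b hb => ?_) k
  have hb' : searchIndex p r (j :: l) z b = searchIndex p r l z b := by
    cases b with
    | none => rfl
    | some i =>
      have : i ≠ j := fun e => hb (by rw [e])
      simp [searchIndex, this]
  rw [hb']
  refine (le_searchIndex_of_indexPlan_ne_zero h b).trans_lt ?_
  simpa [searchIndex, hj] using hz

lemma loss_indexPlan (z : Fin n → ℝ) (k : ℕ) (l : List (Fin n)) :
    loss r (indexPlan p r) z k l = 0 := by
  induction k generalizing l with
  | zero => rfl
  | succ k ih =>
    rw [loss]
    refine Finset.sum_eq_zero fun j _ => ?_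
    by_cases hj : j ∈ l
    · simp [hj]
    rw [if_neg hj, ih]
    by_cases h : indexPlan p r l z (some j) = 0
    · rw [h, zero_mul]
    rcases le_or_gt (z j) (r j) with hz | hz
    · simp [hz]
    · simp [purchaseProb_indexPlan_of_excess hj h hz]

/-- Net values never exceed indices, so a chosen option whose net value equals its index has the
greatest net value. Stopping is such an option and is worth `0`; hence it has probability zero
unless `M = 0`, and may be dropped from the sum. -/
lemma indexPlan_mul_of_isGreatest {l : List (Fin n)} {z : Fin n → ℝ} {M : ℝ}
    (hM : IsGreatest (Set.range (netValue p r l z)) M) :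
    (∀ i, i ∈ l → indexPlan p r l z (some i) * netValue p r l z (some i) =
      indexPlan p r l z (some i) * M) ∧ ∑ i, indexPlan p r l z (some i) * M = M := by
  have hbest : ∀ a, indexPlan p r l z a ≠ 0 → netValue p r l z a = searchIndex p r l z a →
      netValue p r l z a = M := by
    intro a ha e
    refine le_antisymm (hM.2 ⟨a, rfl⟩) ?_
    obtain ⟨b, hb⟩ := hM.1
    rw [← hb, e]
    exact (netValue_le_searchIndex l z b).trans (le_searchIndex_of_indexPlan_ne_zero ha b)
  have hnone : indexPlan p r l z none * M = 0 := by
    by_cases h : indexPlan p r l z none = 0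
    · simp [h]
    · rw [← hbest none h rfl]; simp [netValue]
  constructor
  · intro i hi
    by_cases h : indexPlan p r l z (some i) = 0
    · simp [h]
    · rw [hbest _ h (by simp [netValue, searchIndex, hi])]
  · have := (isSearchPlan_indexPlan p r).sum_eq_one l z
    rw [Fintype.sum_option] at this
    rw [← Finset.sum_mul]
    linear_combination M * this - hnone

lemma exists_isGreatest_netValue (p r : Fin n → ℝ) (l : List (Fin n)) (z : Fin n → ℝ) :
    ∃ M, IsGreatest (Set.range (netValue p r l z)) M := by
  obtain ⟨a, ha⟩ := Finite.exists_max (netValue p r l z)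
  exact ⟨_, ⟨a, rfl⟩, by rintro _ ⟨b, rfl⟩; exact ha b⟩

/-- The index rule secures the best net value on every path. The condition on `k` makes all firms
visited when the recursion ends. -/
theorem sum_purchaseProb_indexPlan (z : Fin n → ℝ) (k : ℕ) (l : List (Fin n)) (hl : l.Nodup)
    (hk : l.length + k = n) {M : ℝ} (hM : IsGreatest (Set.range (netValue p r l z)) M) :
    ∑ i, purchaseProb (indexPlan p r) z k l i * netValue p r l z (some i) = M := by
  induction k generalizing l M with
  | zero =>
    have hall : ∀ i, i ∈ l := fun i => by
      have : l.toFinset = Finset.univ := Finset.eq_univ_of_card _ (by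
        rw [List.toFinset_card_of_nodup hl]; simpa using hk)
      rw [← List.mem_toFinset, this]; exact Finset.mem_univ i
    rw [sum_purchaseProb_zero]
    conv_rhs => rw [← (indexPlan_mul_of_isGreatest hM).2]
    exact Finset.sum_congr rfl fun i _ => by rw [if_pos (hall i), (indexPlan_mul_of_isGreatest hM).1 i (hall i)]
  | succ k ih =>
    rw [sum_purchaseProb_succ, ← Finset.sum_add_distrib]
    conv_rhs => rw [← (indexPlan_mul_of_isGreatest hM).2]
    refine Finset.sum_congr rfl fun j _ => ?_
    by_cases hj : j ∈ l
    · simp [hj, (indexPlan_mul_of_isGreatest hM).1 j hj]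
    simp only [hj, if_false, zero_add]
    by_cases h : indexPlan p r l z (some j) = 0
    · simp [h]
    congr 1
    obtain ⟨M', hM'⟩ := exists_isGreatest_netValue p r (j :: l) z
    have e := ih (j :: l) (List.nodup_cons.2 ⟨hj, hl⟩) (by simp; omega) hM'
    rw [sum_purchaseProb_netValue_cons p r _ hj, e]
    -- Without excess the visit leaves all net values, hence the maximum, unchanged. With excess,
    -- `j` is bought for sure, and the increase of the maximum is exactly the excess that is
    -- subtracted.
    rcases le_or_gt (z j) (r j) with hz | hz
    · have : netValue p r (j :: l) z = netValue p r l z := by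
        funext a
        cases a with
        | none => rfl
        | some i => rw [netValue_cons p r hj]; simp [hz]
      rw [this] at hM'
      rw [hM'.unique hM]; simp [hz]
    · have h1 : M = r j - p j := by
        refine hM.unique ⟨⟨some j, by simp [netValue, hj, hz.le]⟩, ?_⟩
        rintro _ ⟨b, rfl⟩
        refine (netValue_le_searchIndex l z b).trans
          ((le_searchIndex_of_indexPlan_ne_zero h b).trans ?_)
        simp [searchIndex, hj]
      have h2 : M' = z j - p j := by
        refine hM'.unique ⟨⟨some j, by simp [netValue]⟩, ?_⟩
        rintro _ ⟨b, rfl⟩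
        cases b with
        | none =>
          have : netValue p r l z none ≤ M := hM.2 ⟨_, rfl⟩
          simp only [netValue] at this ⊢
          linarith
        | some i =>
          have : netValue p r l z (some i) ≤ M := hM.2 ⟨_, rfl⟩
          rw [netValue_cons p r hj, max_eq_left (by linarith)] at this
          split_ifs at this <;> linarith
      rw [purchaseProb_indexPlan_of_excess hj h hz, h1, h2, max_eq_left (by linarith)]
      ring

lemma sum_purchaseProb_netValue_le {δ : SearchPlan n} (hδ : IsSearchPlan δ) (z : Fin n → ℝ)
    (k : ℕ) (l : List (Fin n)) {M : ℝ} (hM : IsGreatest (Set.range (netValue p r l z)) M) :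
    ∑ i, purchaseProb δ z k l i * netValue p r l z (some i) ≤ M := by
  have hM0 : 0 ≤ M := hM.2 ⟨none, rfl⟩
  calc _ ≤ ∑ i, purchaseProb δ z k l i * M := Finset.sum_le_sum fun i _ =>
        mul_le_mul_of_nonneg_left (hM.2 ⟨_, rfl⟩) (purchaseProb_nonneg hδ _ _ _ _)
    _ ≤ 1 * M := by
        rw [← Finset.sum_mul]
        exact mul_le_mul_of_nonneg_right (sum_purchaseProb_le_one hδ _ _ _) hM0
    _ = M := one_mul M

lemma expectedVisits_mem {δ : SearchPlan n} (hδ : IsSearchPlan δ) (z : Fin n → ℝ) (k : ℕ)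
    (l : List (Fin n)) : expectedVisits δ z k l ∈ Set.Icc (0 : ℝ) k := by
  induction k generalizing l with
  | zero => simp [expectedVisits]
  | succ k ih =>
    rw [expectedVisits]
    constructor
    · refine Finset.sum_nonneg fun j _ => ?_
      split_ifs
      exacts [le_rfl, mul_nonneg (hδ.nonneg _ _ _) (add_nonneg zero_le_one (ih _).1)]
    · calc _ ≤ ∑ j, δ l z (some j) * (1 + k) := Finset.sum_le_sum fun j _ => by
            have := hδ.nonneg l z (some j)
            split_ifs
            · positivity
            · exact mul_le_mul_of_nonneg_left (by linarith [(ih (j :: l)).2]) this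
        _ ≤ 1 * (1 + k) := by
            rw [← Finset.sum_mul]
            exact mul_le_mul_of_nonneg_right (sum_some_le_one hδ l z) (by positivity)
        _ = _ := by push_cast; ring

variable {G : Fin n → Measure ℝ} [∀ j, IsProbabilityMeasure (G j)]

lemma integrable_payoff (hG : ∀ j, ∀ᵐ x ∂(G j), x ∈ Set.Icc (0 : ℝ) 1) {δ : SearchPlan n}
    (hδ : IsSearchPlan δ) (c : ℝ) (p : Fin n → ℝ) (k : ℕ) (l : List (Fin n)) :
    Integrable (fun z => payoff c p δ k l z) (Measure.pi G) := by
  refine integrable_of_abs_le (measurable_payoff hδ c p k l) (∑ i, (1 + |p i|) + |c| * k) ?_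
  filter_upwards [ae_pi_mem_Icc hG] with z hz
  rw [payoff]
  refine (abs_sub _ _).trans (add_le_add ((Finset.abs_sum_le_sum_abs _ _).trans
    (Finset.sum_le_sum fun i _ => ?_)) ?_)
  · rw [abs_mul, abs_of_nonneg (purchaseProb_nonneg hδ _ _ _ _)]
    refine (mul_le_of_le_one_left (abs_nonneg _) (purchaseProb_le_one hδ _ _ _ _)).trans ?_
    refine (abs_sub _ _).trans (add_le_add ?_ le_rfl)
    rw [abs_of_nonneg (hz i).1]; exact (hz i).2
  · rw [abs_mul, abs_of_nonneg (expectedVisits_mem hδ z k l).1]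
    exact mul_le_mul_of_nonneg_left (expectedVisits_mem hδ z k l).2 (abs_nonneg _)

lemma integrable_drift (hG : ∀ j, ∀ᵐ x ∂(G j), x ∈ Set.Icc (0 : ℝ) 1) {δ : SearchPlan n}
    (hδ : IsSearchPlan δ) (c : ℝ) (r : Fin n → ℝ) (k : ℕ) (l : List (Fin n)) :
    Integrable (fun z => drift c r δ z k l) (Measure.pi G) := by
  obtain ⟨C, hC⟩ := exists_abs_drift_le hδ c r k l
  exact integrable_of_abs_le (measurable_drift hδ c r k l) C
    ((ae_pi_mem_Icc hG).mono fun z hz => hC z hz)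

/-- The drift drops out in expectation. Integrability is inherited from the payoff and the drift, so
the loss needs no bound of its own. -/
lemma integral_payoff (hG : ∀ j, ∀ᵐ x ∂(G j), x ∈ Set.Icc (0 : ℝ) 1) {δ : SearchPlan n}
    (hδ : IsSearchPlan δ) {c : ℝ} {p r : Fin n → ℝ} (k : ℕ) (l : List (Fin n))
    (hr : ∀ j, j ∉ l → ∫ x, max (x - r j) 0 ∂(G j) = c) :
    Integrable (fun z => ∑ i, purchaseProb δ z k l i * netValue p r l z (some i)
        - loss r δ z k l) (Measure.pi G) ∧
      ∫ z, (∑ i, purchaseProb δ z k l i * netValue p r l z (some i) - loss r δ z k l)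
        ∂(Measure.pi G) = ∫ z, payoff c p δ k l z ∂(Measure.pi G) := by
  have e : (fun z => ∑ i, purchaseProb δ z k l i * netValue p r l z (some i) - loss r δ z k l) =
      fun z => payoff c p δ k l z - drift c r δ z k l := by
    funext z; rw [payoff_eq c p r]; ring
  rw [e]
  refine ⟨(integrable_payoff hG hδ c p k l).sub (integrable_drift hG hδ c r k l), ?_⟩
  rw [integral_sub (integrable_payoff hG hδ c p k l) (integrable_drift hG hδ c r k l)]
  have := integral_mul_drift hG hδ k l hr (φ := fun _ => 1) measurable_const
    (fun _ => zero_le_one) (fun _ => le_rfl) (fun _ _ _ => rfl)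
  simp only [one_mul] at this
  rw [this, sub_zero]

/-- Apart from the drift the comparison is pathwise: any plan gets at most the greatest net value
minus a nonnegative loss, and the index rule gets that value with no loss. -/
theorem integral_payoff_le_indexPlan (hG : ∀ j, ∀ᵐ x ∂(G j), x ∈ Set.Icc (0 : ℝ) 1)
    {δ : SearchPlan n} (hδ : IsSearchPlan δ) {c : ℝ} {p r : Fin n → ℝ} (k : ℕ)
    (l : List (Fin n)) (hl : l.Nodup) (hk : l.length + k = n)
    (hr : ∀ j, j ∉ l → ∫ x, max (x - r j) 0 ∂(G j) = c) :
    ∫ z, payoff c p δ k l z ∂(Measure.pi G) ≤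
      ∫ z, payoff c p (indexPlan p r) k l z ∂(Measure.pi G) := by
  have h1 := integral_payoff (p := p) hG hδ k l hr
  have h2 := integral_payoff (p := p) hG (isSearchPlan_indexPlan p r) k l hr
  rw [← h1.2, ← h2.2]
  refine integral_mono h1.1 h2.1 fun z => ?_
  obtain ⟨M, hM⟩ := exists_isGreatest_netValue p r l z
  simp only
  rw [loss_indexPlan, sub_zero, sum_purchaseProb_indexPlan z k l hl hk hM]
  linarith [sum_purchaseProb_netValue_le hδ z k l hM, loss_nonneg hδ r z k l]

/-- A plan that does as well as the index plan buys only options with the highest net value. -/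
theorem ae_isGreatest_of_optimal (hG : ∀ j, ∀ᵐ x ∂(G j), x ∈ Set.Icc (0 : ℝ) 1)
    {δ : SearchPlan n} (hδ : IsSearchPlan δ) {c : ℝ} {p r : Fin n → ℝ}
    (hr : ∀ j, ∫ x, max (x - r j) 0 ∂(G j) = c)
    (h : ∫ z, payoff c p (indexPlan p r) n [] z ∂(Measure.pi G) ≤
      ∫ z, payoff c p δ n [] z ∂(Measure.pi G)) :
    ∀ᵐ z ∂(Measure.pi G), IsGreatest (Set.range (netValue p r [] z))
      (∑ i, purchaseProb δ z n [] i * netValue p r [] z (some i)) := by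
  have h1 := integral_payoff (p := p) hG hδ n [] fun j _ => hr j
  have h2 := integral_payoff (p := p) hG (isSearchPlan_indexPlan p r) n [] fun j _ => hr j
  rw [← h1.2, ← h2.2, ← sub_nonpos, ← integral_sub h2.1 h1.1] at h
  have hM := exists_isGreatest_netValue p r []
  -- The pathwise advantage of the index rule is nonnegative; having integral at most zero, it
  -- vanishes almost everywhere.
  have h0 : ∀ z, 0 ≤ (∑ i, purchaseProb (indexPlan p r) z n [] i * netValue p r [] z (some i) -
      loss r (indexPlan p r) z n []) -
      (∑ i, purchaseProb δ z n [] i * netValue p r [] z (some i) - loss r δ z n []) := by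
    intro z
    obtain ⟨M, hM⟩ := hM z
    rw [loss_indexPlan, sub_zero, sum_purchaseProb_indexPlan z n [] List.nodup_nil (by simp) hM]
    linarith [sum_purchaseProb_netValue_le hδ z n [] hM, loss_nonneg hδ r z n []]
  have h3 := (integral_eq_zero_iff_of_nonneg h0 (h2.1.sub h1.1)).1
    (le_antisymm h (integral_nonneg h0))
  filter_upwards [h3] with z hz
  obtain ⟨M, hM⟩ := hM z
  simp only [Pi.zero_apply] at hz
  rw [loss_indexPlan, sub_zero, sum_purchaseProb_indexPlan z n [] List.nodup_nil (by simp) hM]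
    at hz
  rwa [le_antisymm (sum_purchaseProb_netValue_le hδ z n [] hM)
    (by linarith [loss_nonneg hδ r z n []])]

end Index

/-! ### Sequential rationality and its consequences for purchases -/

section Consumer

variable {n : ℕ} {μ c : ℝ}

/-- Observed posteriors are absorbed into the product measure: the signal of a visited firm is
pushed forward to a point mass. The results for product measures then apply at every history. -/
lemma continuationValue_eq (s : Fin n → Offer μ) {δ : SearchPlan n} (hδ : IsSearchPlan δ)
    (l : List (Fin n)) (x : Fin n → ℝ) : continuationValue c s δ l x =
      ∫ z, payoff c (fun i => price (s i)) δ (n - l.length) l z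
        ∂(Measure.pi fun j => (signal (s j)).map fun t => if j ∈ l then x j else t) := by
  have hm : ∀ j, Measurable fun t : ℝ => if j ∈ l then x j else t := fun j => by
    split_ifs
    exacts [measurable_const, measurable_id]
  have : ∀ j, SigmaFinite ((signal (s j)).map fun t => if j ∈ l then x j else t) := fun j => by
    have := Measure.isProbabilityMeasure_map (μ := signal (s j)) (hm j).aemeasurable
    infer_instance
  rw [← Measure.pi_map_pi fun j => (hm j).aemeasurable, integral_map]
  · rfl
  · exact (measurable_pi_lambda _ fun j => (hm j).comp (measurable_pi_apply j)).aemeasurable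
  · exact (measurable_payoff hδ c _ _ l).aestronglyMeasurable

/-- The consumer strategy of Weitzman's index rule. -/
def indexStrategy (n : ℕ) (μ c : ℝ) : ConsumerStrategy n μ := fun s =>
  indexPlan (fun i => price (s i)) (fun i => reservation c (s i))

theorem isSequentiallyRational_indexStrategy (hc : 0 ≤ c) (hcμ : c ≤ μ) :
    IsSequentiallyRational c (indexStrategy n μ c) where
  isSearchPlan s := isSearchPlan_indexPlan _ _
  measurable l a := measurable_indexPlan
    (fun j => measurable_price.comp ((measurable_pi_apply j).comp measurable_fst))
    (fun j => (measurable_reservation hcμ).comp ((measurable_pi_apply j).comp measurable_fst))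
    (fun j => (measurable_pi_apply j).comp measurable_snd) l a
  optimal s l x hl hx δ hδ := by
    rw [continuationValue_eq s hδ, indexStrategy,
      continuationValue_eq s (isSearchPlan_indexPlan _ _)]
    have hm : ∀ j, Measurable fun t : ℝ => if j ∈ l then x j else t := fun j => by
      split_ifs
      exacts [measurable_const, measurable_id]
    have := fun j => Measure.isProbabilityMeasure_map (μ := signal (s j)) (hm j).aemeasurable
    refine integral_payoff_le_indexPlan (fun j => ?_) hδ _ l hl ?_ fun j hj => ?_
    · refine (ae_map_iff (hm j).aemeasurable measurableSet_Icc).2 ?_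
      filter_upwards [ae_mem_Icc_signal (s j)] with t ht
      split_ifs
      exacts [hx j, ht]
    · have := hl.length_le_card
      simp only [Fintype.card_fin] at this
      omega
    · simp only [hj, if_false, Measure.map_id']
      exact excess_reservation hc hcμ (s j)

/-- The value of an offer with a given posterior, truncated at the reservation value. -/
def netTruncated (c : ℝ) (z : Offer μ × ℝ) : ℝ := truncated c z - price z.1

/-- At the empty history the plan does at least as well as the index rule, so its purchases attain
the greatest net value almost surely. How ties are broken remains open. -/
lemma ae_optimal_purchase (hc : 0 ≤ c) (hcμ : c ≤ μ) {γ : ConsumerStrategy n μ}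
    (hγ : IsSequentiallyRational c γ) (s : Fin n → Offer μ) :
    ∀ᵐ x ∂(Measure.pi fun j => signal (s j)), ∀ i,
      (0 < purchaseProb (γ s) x n [] i → 0 ≤ netTruncated c (s i, x i) ∧
        ∀ j, netTruncated c (s j, x j) ≤ netTruncated c (s i, x i)) ∧
      (0 < netTruncated c (s i, x i) →
        (∀ j, j ≠ i → netTruncated c (s j, x j) < netTruncated c (s i, x i)) →
        purchaseProb (γ s) x n [] i = 1) := by
  have hδ := hγ.isSearchPlan s
  have hopt := hγ.optimal s [] 0 List.nodup_nil (fun j => by simp) _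
    (isSearchPlan_indexPlan (fun i => price (s i)) (fun i => reservation c (s i)))
  rw [continuationValue_eq s hδ, continuationValue_eq s (isSearchPlan_indexPlan _ _)] at hopt
  simp only [List.not_mem_nil, if_false, Measure.map_id', List.length_nil, Nat.sub_zero] at hopt
  have h := ae_isGreatest_of_optimal (fun j => ae_mem_Icc_signal (s j)) hδ
    (fun j => excess_reservation hc hcμ (s j)) hopt
  filter_upwards [h] with x hx
  have hnet : ∀ i, netValue (fun i => price (s i)) (fun i => reservation c (s i)) [] x (some i) =
      netTruncated c (s i, x i) := fun i => by simp [netValue, netTruncated, truncated]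
  simp only [hnet] at hx
  set A := fun i => purchaseProb (γ s) x n [] i
  set w := fun i => netTruncated c (s i, x i)
  set M := ∑ i, A i * w i with hMdef
  change IsGreatest _ M at hx
  have hA0 : ∀ i, 0 ≤ A i := purchaseProb_nonneg hδ x n []
  have hA1 : ∑ i, A i ≤ 1 := sum_purchaseProb_le_one hδ x n []
  have hM0 : 0 ≤ M := hx.2 ⟨none, rfl⟩
  have hMw : ∀ i, w i ≤ M := fun i => hx.2 ⟨some i, hnet i⟩
  -- The slack splits into nonnegative terms, one for each suboptimal purchase and one for not
  -- buying; all of them vanish.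
  have hzero : ∑ i, A i * (M - w i) + (1 - ∑ i, A i) * M = 0 := by
    simp only [mul_sub, Finset.sum_sub_distrib, ← Finset.sum_mul]
    rw [← hMdef]; ring
  have ht : ∀ i, 0 ≤ A i * (M - w i) := fun i => mul_nonneg (hA0 i) (sub_nonneg.2 (hMw i))
  have hs : 0 ≤ ∑ i, A i * (M - w i) := Finset.sum_nonneg fun i _ => ht i
  have hs' : 0 ≤ (1 - ∑ i, A i) * M := mul_nonneg (by linarith) hM0
  have hterm : ∀ i, A i * (M - w i) = 0 := fun i =>
    (Finset.sum_eq_zero_iff_of_nonneg fun i _ => ht i).1 (by linarith) i (Finset.mem_univ i)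
  have hbuy : ∀ i, 0 < A i → w i = M := fun i hi => by
    rcases mul_eq_zero.1 (hterm i) with h | h <;> linarith
  intro i
  refine ⟨fun hi => ?_, fun hi hj => ?_⟩
  · change 0 ≤ w i ∧ ∀ j, w j ≤ w i
    rw [hbuy i hi]
    exact ⟨hM0, hMw⟩
  · have hMpos : 0 < M := lt_of_lt_of_le hi (hMw i)
    have hsum : ∑ i, A i = 1 := by
      rcases mul_eq_zero.1 (show (1 - ∑ i, A i) * M = 0 by linarith) with h | h <;> linarith
    have : ∑ j, A j = A i := by
      refine Finset.sum_eq_single i (fun j _ hji => ?_) (by simp)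
      by_contra h0
      have := hbuy j (lt_of_le_of_ne (hA0 j) (Ne.symm h0))
      have h1 : w j < w i := hj j hji
      linarith [hMw i]
    change A i = 1
    rw [← this, hsum]

end Consumer

/-! ### Offers together with their realized posteriors -/

section Joint

variable {n : ℕ} {μ c : ℝ}

/-- The joint law of an offer drawn from `τ` and the posterior that it generates. -/
def joint (τ : Measure (Offer μ)) : Measure (Offer μ × ℝ) := τ ⊗ₘ signalKernel μ

instance (τ : Measure (Offer μ)) [IsProbabilityMeasure τ] : IsProbabilityMeasure (joint τ) := by
  rw [joint]; infer_instance

/-- The kernel that draws the posteriors of all firms. -/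
def signalsKernel (n : ℕ) (μ : ℝ) : Kernel (Fin n → Offer μ) (Fin n → ℝ) where
  toFun s := Measure.pi fun j => signal (s j)
  measurable' := by
    refine Measurable.measure_of_isPiSystem_of_isProbabilityMeasure generateFrom_pi.symm
      isPiSystem_pi ?_
    rintro _ ⟨B, hB, rfl⟩
    simp only [Measure.pi_pi]
    exact Finset.measurable_prod _ fun j _ =>
      ((signalKernel μ).measurable_coe (hB j (Set.mem_univ j))).comp (measurable_pi_apply j)

instance : IsMarkovKernel (signalsKernel n μ) :=
  ⟨fun s => by change IsProbabilityMeasure (Measure.pi fun j => signal (s j)); infer_instance⟩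

lemma measurable_zip : Measurable fun (q : (Fin n → Offer μ) × (Fin n → ℝ)) (j : Fin n) =>
    (q.1 j, q.2 j) :=
  measurable_pi_lambda _ fun j => ((measurable_pi_apply j).comp measurable_fst).prodMk
    ((measurable_pi_apply j).comp measurable_snd)

/-- Given the offers, posteriors are independent and each depends on its own offer only, so the
pairs (offer, posterior) are independent across firms. On boxes this is the factorization of the
integral of a product of independent functions. -/
theorem map_compProd_signalsKernel (τ : Fin n → Measure (Offer μ))
    [∀ j, IsProbabilityMeasure (τ j)] :
    (Measure.pi τ ⊗ₘ signalsKernel n μ).map (fun q j => (q.1 j, q.2 j)) =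
      Measure.pi fun j => joint (τ j) := by
  refine (Measure.pi_eq fun B hB => ?_).symm
  have hX : ∀ j, Measurable fun a : Offer μ => signal a (Prod.mk a ⁻¹' B j) := fun j =>
    Kernel.measurable_kernel_prodMk_left (κ := signalKernel μ) (hB j)
  rw [Measure.map_apply measurable_zip (MeasurableSet.univ_pi hB),
    Measure.compProd_apply (measurable_zip (MeasurableSet.univ_pi hB))]
  have hind := iIndepFun_pi (μ := τ) (X := fun j a => signal a (Prod.mk a ⁻¹' B j))
    fun j => (hX j).aemeasurable
  have hbox : ∀ s : Fin n → Offer μ, signalsKernel n μ s (Prod.mk s ⁻¹'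
      ((fun (q : (Fin n → Offer μ) × (Fin n → ℝ)) (j : Fin n) => (q.1 j, q.2 j)) ⁻¹'
        Set.univ.pi B)) = ∏ j, signal (s j) (Prod.mk (s j) ⁻¹' B j) := by
    intro s
    change Measure.pi (fun j => signal (s j)) _ = _
    rw [← Measure.pi_pi]
    congr 1
  simp_rw [hbox]
  refine (lintegral_prod_eq_prod_lintegral_of_indepFun Finset.univ
    (fun j (s : Fin n → Offer μ) => signal (s j) (Prod.mk (s j) ⁻¹' B j)) hind
    fun j => (hX j).comp (measurable_pi_apply j)).trans ?_
  refine Finset.prod_congr rfl fun j _ => ?_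
  rw [joint, Measure.compProd_apply (hB j)]
  exact (measurePreserving_eval τ j).lintegral_comp (hX j)

/-- The probability that firm `i` sells, as a function of all offers and posteriors. -/
def sale (γ : ConsumerStrategy n μ) (i : Fin n) (ω : Fin n → Offer μ × ℝ) : ℝ :=
  purchaseProb (γ fun j => (ω j).1) (fun j => (ω j).2) n [] i

lemma measurable_sale {γ : ConsumerStrategy n μ} (hγ : IsSequentiallyRational c γ) (i : Fin n) :
    Measurable (sale γ i) := by
  refine measurable_purchaseProb (δ := fun ω : Fin n → Offer μ × ℝ => γ fun j => (ω j).1)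
    (z := fun ω j => (ω j).2) (fun l a => ?_) n [] i
  exact (hγ.measurable l a).comp ((measurable_pi_lambda _ fun j =>
    measurable_fst.comp (measurable_pi_apply j)).prodMk
    (measurable_pi_lambda _ fun j => measurable_snd.comp (measurable_pi_apply j)))

lemma sale_nonneg {γ : ConsumerStrategy n μ} (hγ : IsSequentiallyRational c γ) (i : Fin n)
    (ω : Fin n → Offer μ × ℝ) : 0 ≤ sale γ i ω :=
  purchaseProb_nonneg (hγ.isSearchPlan _) _ _ _ _

lemma sum_sale_le_one {γ : ConsumerStrategy n μ} (hγ : IsSequentiallyRational c γ)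
    (ω : Fin n → Offer μ × ℝ) : ∑ i, sale γ i ω ≤ 1 :=
  sum_purchaseProb_le_one (hγ.isSearchPlan _) _ _ _

lemma measurable_netTruncated (hcμ : c ≤ μ) : Measurable (netTruncated c : Offer μ × ℝ → ℝ) :=
  (measurable_truncated hcμ).sub (measurable_price.comp measurable_fst)

/-- Firm `i` sells only if its offer is best, and it does if its offer is the unique best one. -/
def IsOptimalSale (c : ℝ) (γ : ConsumerStrategy n μ) (i : Fin n) (ω : Fin n → Offer μ × ℝ) :
    Prop :=
  (0 < sale γ i ω → 0 ≤ netTruncated c (ω i) ∧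
      ∀ j, netTruncated c (ω j) ≤ netTruncated c (ω i)) ∧
    (0 < netTruncated c (ω i) →
      (∀ j, j ≠ i → netTruncated c (ω j) < netTruncated c (ω i)) → sale γ i ω = 1)

variable (τ : Fin n → Measure (Offer μ)) [∀ j, IsProbabilityMeasure (τ j)]

lemma measurable_isOptimalSale (hcμ : c ≤ μ) {γ : ConsumerStrategy n μ}
    (hγ : IsSequentiallyRational c γ) (i : Fin n) : Measurable (IsOptimalSale c γ i) := by
  have hw : ∀ j, Measurable fun ω : Fin n → Offer μ × ℝ => netTruncated c (ω j) := fun j =>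
    (measurable_netTruncated hcμ).comp (measurable_pi_apply j)
  have hs := measurable_sale hγ i
  refine Measurable.and (Measurable.imp ?_ (Measurable.and ?_ (Measurable.forall fun j => ?_)))
    (Measurable.imp ?_ (Measurable.imp (Measurable.forall fun j =>
      Measurable.imp measurable_const ?_) ?_))
  · exact measurableSet_setOfPred.1 (measurableSet_lt measurable_const hs)
  · exact measurableSet_setOfPred.1 (measurableSet_le measurable_const (hw i))
  · exact measurableSet_setOfPred.1 (measurableSet_le (hw j) (hw i))
  · exact measurableSet_setOfPred.1 (measurableSet_lt measurable_const (hw i))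
  · exact measurableSet_setOfPred.1 (measurableSet_lt (hw j) (hw i))
  · exact measurableSet_setOfPred.1 (measurableSet_eq_fun hs measurable_const)

lemma ae_isOptimalSale (hc : 0 ≤ c) (hcμ : c ≤ μ) {γ : ConsumerStrategy n μ}
    (hγ : IsSequentiallyRational c γ) (i : Fin n) :
    ∀ᵐ ω ∂(Measure.pi fun j => joint (τ j)), IsOptimalSale c γ i ω := by
  have hm := measurableSet_setOfPred.2 (measurable_isOptimalSale hcμ hγ i)
  rw [← map_compProd_signalsKernel]
  refine (ae_map_iff measurable_zip.aemeasurable hm).2 ?_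
  refine Measure.ae_compProd_of_ae_ae (measurable_zip hm) (Filter.Eventually.of_forall fun s => ?_)
  filter_upwards [ae_optimal_purchase hc hcμ hγ s] with x hx
  exact hx i

lemma ae_joint_of_forall {σ : Measure (Offer μ)} [IsProbabilityMeasure σ]
    {q : Offer μ × ℝ → Prop} (hq : Measurable q) (h : ∀ a, ∀ᵐ x ∂(signal a), q (a, x)) :
    ∀ᵐ z ∂(joint σ), q z :=
  Measure.ae_compProd_of_ae_ae (measurableSet_setOfPred.2 hq) (Filter.Eventually.of_forall h)

lemma ae_truncated_nonneg (hcμ : c ≤ μ) {σ : Measure (Offer μ)} [IsProbabilityMeasure σ] :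
    ∀ᵐ z ∂(joint σ), 0 ≤ truncated c z :=
  ae_joint_of_forall (measurableSet_setOfPred.1
    (measurableSet_le measurable_const (measurable_truncated hcμ))) (truncated_nonneg hcμ)

lemma abs_truncated_le (hμ : 0 < μ) (hc : 0 ≤ c) (hcμ : c ≤ μ) {σ : Measure (Offer μ)}
    [IsProbabilityMeasure σ] : ∀ᵐ z ∂(joint σ), |truncated c z| ≤ 1 := by
  filter_upwards [ae_truncated_nonneg hcμ] with z hz
  rw [abs_of_nonneg hz]
  exact (truncated_le hμ hc hcμ z).trans (maxReservation_le_one hμ hc)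

lemma integrable_truncated_joint (hμ : 0 < μ) (hc : 0 ≤ c) (hcμ : c ≤ μ)
    {σ : Measure (Offer μ)} [IsProbabilityMeasure σ] : Integrable (truncated c) (joint σ) :=
  integrable_of_abs_le (measurable_truncated hcμ) 1 (abs_truncated_le hμ hc hcμ)

lemma integral_truncated_joint (hμ : 0 < μ) (hc : 0 ≤ c) (hcμ : c ≤ μ) {σ : Measure (Offer μ)}
    [IsProbabilityMeasure σ] : ∫ z, truncated c z ∂(joint σ) = μ - c := by
  have := Measure.integral_compProd (integrable_truncated_joint hμ hc hcμ (σ := σ))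
  rw [joint, this]
  simp [integral_truncated hc hcμ]

/-- The price of an offer whose realized net value is nonnegative, and `0` for others. -/
def acceptablePrice (c : ℝ) (z : Offer μ × ℝ) : ℝ :=
  {z | 0 ≤ netTruncated c z}.indicator (fun z => price z.1) z

lemma measurable_acceptablePrice (hcμ : c ≤ μ) :
    Measurable (acceptablePrice c : Offer μ × ℝ → ℝ) :=
  (measurable_price.comp measurable_fst).indicator
    (measurableSet_le measurable_const (measurable_netTruncated hcμ))

lemma acceptablePrice_nonneg (z : Offer μ × ℝ) : 0 ≤ acceptablePrice c z :=
  Set.indicator_nonneg (fun z _ => price_nonneg z.1) z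

lemma acceptablePrice_le_truncated (hcμ : c ≤ μ) {σ : Measure (Offer μ)}
    [IsProbabilityMeasure σ] : ∀ᵐ z ∂(joint σ), acceptablePrice c z ≤ truncated c z := by
  filter_upwards [ae_truncated_nonneg hcμ] with z hz
  refine Set.indicator_apply_le' (fun h => ?_) fun _ => hz
  have : 0 ≤ truncated c z - price z.1 := h
  linarith

/-- Posted prices are unbounded, but a price that can be accepted is at most the truncated
posterior. All integrability of profits rests on this. -/
lemma abs_acceptablePrice_le (hμ : 0 < μ) (hc : 0 ≤ c) (hcμ : c ≤ μ) {σ : Measure (Offer μ)}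
    [IsProbabilityMeasure σ] : ∀ᵐ z ∂(joint σ), |acceptablePrice c z| ≤ 1 := by
  filter_upwards [acceptablePrice_le_truncated hcμ] with z hz
  rw [abs_of_nonneg (acceptablePrice_nonneg z)]
  exact hz.trans ((truncated_le hμ hc hcμ z).trans (maxReservation_le_one hμ hc))

/-- The upper bound resolves every tie, including one with the outside option, in favour of firm
`i`. -/
lemma price_mul_sale_le {γ : ConsumerStrategy n μ} (hγ : IsSequentiallyRational c γ) {i : Fin n}
    {ω : Fin n → Offer μ × ℝ} (h : IsOptimalSale c γ i ω) :
    price (ω i).1 * sale γ i ω ≤ {ω : Fin n → Offer μ × ℝ | ∀ j, j ≠ i →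
      netTruncated c (ω j) ≤ netTruncated c (ω i)}.indicator
        (fun ω => acceptablePrice c (ω i)) ω := by
  have h0 := sale_nonneg hγ i ω
  have h1 : sale γ i ω ≤ 1 := purchaseProb_le_one (hγ.isSearchPlan _) _ _ _ _
  have hI : 0 ≤ {ω : Fin n → Offer μ × ℝ | ∀ j, j ≠ i →
      netTruncated c (ω j) ≤ netTruncated c (ω i)}.indicator
        (fun ω => acceptablePrice c (ω i)) ω :=
    Set.indicator_nonneg (fun ω _ => acceptablePrice_nonneg _) _
  rcases h0.eq_or_lt with h0 | h0
  · rw [← h0, mul_zero]; exact hI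
  · obtain ⟨h2, h3⟩ := h.1 h0
    rw [Set.indicator_of_mem (show ω ∈ {ω : Fin n → Offer μ × ℝ | ∀ j, j ≠ i →
      netTruncated c (ω j) ≤ netTruncated c (ω i)} from fun j _ => h3 j)]
    rw [acceptablePrice, Set.indicator_of_mem (show ω i ∈ {z | 0 ≤ netTruncated c z} from h2)]
    exact mul_le_of_le_one_right (price_nonneg _) h1

lemma ae_eval {p : Offer μ × ℝ → Prop} {ρ : Fin n → Measure (Offer μ × ℝ)}
    [∀ j, IsProbabilityMeasure (ρ j)] (i : Fin n) (h : ∀ᵐ z ∂(ρ i), p z) :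
    ∀ᵐ ω ∂(Measure.pi ρ), p (ω i) :=
  (measurePreserving_eval ρ i).quasiMeasurePreserving.ae h

lemma integrable_price_mul_sale (hμ : 0 < μ) (hc : 0 ≤ c) (hcμ : c ≤ μ)
    {γ : ConsumerStrategy n μ} (hγ : IsSequentiallyRational c γ) (i : Fin n) :
    Integrable (fun ω => price (ω i).1 * sale γ i ω) (Measure.pi fun j => joint (τ j)) := by
  refine integrable_of_abs_le ((measurable_price.comp (measurable_fst.comp
    (measurable_pi_apply i))).mul (measurable_sale hγ i)) 1 ?_
  filter_upwards [ae_isOptimalSale τ hc hcμ hγ i,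
    ae_eval (ρ := fun j => joint (τ j)) i (abs_acceptablePrice_le hμ hc hcμ)] with ω h1 h2
  rw [abs_of_nonneg (mul_nonneg (price_nonneg _) (sale_nonneg hγ i ω))]
  refine (price_mul_sale_le hγ h1).trans ?_
  refine Set.indicator_apply_le' (fun _ => (le_abs_self _).trans h2) fun _ => zero_le_one

theorem expectedProfit_eq (hμ : 0 < μ) (hc : 0 ≤ c) (hcμ : c ≤ μ)
    {γ : ConsumerStrategy n μ} (hγ : IsSequentiallyRational c γ) (i : Fin n) :
    expectedProfit γ τ i =
      ∫ ω, price (ω i).1 * sale γ i ω ∂(Measure.pi fun j => joint (τ j)) := by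
  have hI := integrable_price_mul_sale τ hμ hc hcμ hγ i
  rw [← map_compProd_signalsKernel] at hI ⊢
  have e := Measure.integral_compProd (hI.comp_measurable measurable_zip)
  rw [integral_map measurable_zip.aemeasurable hI.aestronglyMeasurable]
  refine Eq.trans ?_ e.symm
  simp only [expectedProfit, profit, sale, Function.comp_apply, integral_const_mul]
  rfl

/-- Fubini's theorem, for the comparison of coordinate `i` with independent copies. -/
theorem integral_pi_indicator {Z : Type*} [MeasurableSpace Z] {m : ℕ} (i : Fin (m + 1))
    {ν : Fin (m + 1) → Measure Z} {ρ : Measure Z} [∀ j, IsProbabilityMeasure (ν j)]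
    (hν : ∀ j, j ≠ i → ν j = ρ) {R : Set (Z × Z)} (hR : MeasurableSet R) {g : Z → ℝ}
    (hg : Integrable g (ν i)) :
    Integrable ({ω : Fin (m + 1) → Z | ∀ j, j ≠ i → (ω i, ω j) ∈ R}.indicator
      fun ω => g (ω i)) (Measure.pi ν) ∧
    ∫ ω, {ω : Fin (m + 1) → Z | ∀ j, j ≠ i → (ω i, ω j) ∈ R}.indicator (fun ω => g (ω i)) ω
      ∂(Measure.pi ν) = ∫ z, g z * ρ.real (Prod.mk z ⁻¹' R) ^ m ∂(ν i) := by
  have hT : MeasurableSet {q : Z × (Fin m → Z) | ∀ k, (q.1, q.2 k) ∈ R} := by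
    simp only [Set.ofPred_forall]
    exact MeasurableSet.iInter fun k => (measurable_fst.prodMk
      ((measurable_pi_apply k).comp measurable_snd)) hR
  have hp := measurePreserving_piFinSuccAbove ν i
  have hf : ({ω : Fin (m + 1) → Z | ∀ j, j ≠ i → (ω i, ω j) ∈ R}.indicator fun ω => g (ω i)) =
      (fun q => {q : Z × (Fin m → Z) | ∀ k, (q.1, q.2 k) ∈ R}.indicator (fun q => g q.1) q) ∘
        MeasurableEquiv.piFinSuccAbove (fun _ => Z) i := by
    funext ω
    have : ω ∈ {ω : Fin (m + 1) → Z | ∀ j, j ≠ i → (ω i, ω j) ∈ R} ↔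
        MeasurableEquiv.piFinSuccAbove (fun _ => Z) i ω ∈
          {q : Z × (Fin m → Z) | ∀ k, (q.1, q.2 k) ∈ R} := by
      constructor
      · intro h k
        exact h _ (Fin.succAbove_ne i k)
      · intro h j hj
        obtain ⟨k, rfl⟩ := Fin.exists_succAbove_eq hj
        exact h k
    by_cases h : ω ∈ {ω : Fin (m + 1) → Z | ∀ j, j ≠ i → (ω i, ω j) ∈ R}
    · rw [Set.indicator_of_mem h, Function.comp_apply, Set.indicator_of_mem (this.1 h)]
      rfl
    · rw [Set.indicator_of_notMem h, Function.comp_apply,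
        Set.indicator_of_notMem fun h' => h (this.2 h')]
  have hI : Integrable (fun q => {q : Z × (Fin m → Z) | ∀ k, (q.1, q.2 k) ∈ R}.indicator
      (fun q => g q.1) q) ((ν i).prod (Measure.pi fun k => ν (i.succAbove k))) :=
    (hg.comp_fst _).indicator hT
  refine ⟨?_, ?_⟩
  · rw [hf]
    exact (hp.integrable_comp_emb (MeasurableEquiv.measurableEmbedding _)).2 hI
  · rw [hf]
    refine (hp.integral_comp' _).trans ?_
    rw [integral_prod _ hI]
    refine integral_congr_ae (Filter.Eventually.of_forall fun z => ?_)
    have hs : MeasurableSet (Set.univ.pi fun _ : Fin m => Prod.mk z ⁻¹' R) :=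
      MeasurableSet.univ_pi fun _ => measurable_prodMk_left hR
    have e : (fun y => {q : Z × (Fin m → Z) | ∀ k, (q.1, q.2 k) ∈ R}.indicator
        (fun q => g q.1) (z, y)) =
        (Set.univ.pi fun _ : Fin m => Prod.mk z ⁻¹' R).indicator fun _ => g z := by
      funext y
      by_cases h : y ∈ Set.univ.pi fun _ : Fin m => Prod.mk z ⁻¹' R
      · rw [Set.indicator_of_mem h, Set.indicator_of_mem]
        exact fun k => h k (Set.mem_univ k)
      · rw [Set.indicator_of_notMem h, Set.indicator_of_notMem]
        exact fun h' => h fun k _ => h' k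
    simp only
    rw [e, integral_indicator hs, setIntegral_const, smul_eq_mul, mul_comm]
    congr 1
    rw [measureReal_def, Measure.pi_pi, ENNReal.toReal_prod]
    simp [hν _ (Fin.succAbove_ne i _), measureReal_def]

end Joint

/-! ### Profits in terms of the distribution of net values -/

section Profit

variable {m : ℕ} {μ c : ℝ} {σ τ : Measure (Offer μ)} [IsProbabilityMeasure σ]
  [IsProbabilityMeasure τ]

instance (i : Fin (m + 1)) (j : Fin (m + 1)) :
    IsProbabilityMeasure (Function.update (fun _ => σ) i τ j) := by
  by_cases h : j = i
  · subst h; simpa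
  · simpa [h]

/-- The distribution function of the net value of an offer drawn from `σ`. -/
def netCDF (c : ℝ) (σ : Measure (Offer μ)) (t : ℝ) : ℝ :=
  (joint σ).real {z | netTruncated c z ≤ t}

/-- The probability that the net value of an offer drawn from `σ` is below `t`. -/
def netCDFLeft (c : ℝ) (σ : Measure (Offer μ)) (t : ℝ) : ℝ :=
  (joint σ).real {z | netTruncated c z < t}

lemma integral_indicator_le (hμ : 0 < μ) (hc : 0 ≤ c) (hcμ : c ≤ μ) (i : Fin (m + 1)) :
    Integrable ({ω : Fin (m + 1) → Offer μ × ℝ | ∀ j, j ≠ i →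
        netTruncated c (ω j) ≤ netTruncated c (ω i)}.indicator fun ω => acceptablePrice c (ω i))
        (Measure.pi fun j => joint (Function.update (fun _ => σ) i τ j)) ∧
      ∫ ω, {ω : Fin (m + 1) → Offer μ × ℝ | ∀ j, j ≠ i →
        netTruncated c (ω j) ≤ netTruncated c (ω i)}.indicator
          (fun ω => acceptablePrice c (ω i)) ω
        ∂(Measure.pi fun j => joint (Function.update (fun _ => σ) i τ j)) =
      ∫ z, acceptablePrice c z * netCDF c σ (netTruncated c z) ^ m ∂(joint τ) := by
  have hw := measurable_netTruncated (μ := μ) hcμ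
  have := integral_pi_indicator i (ν := fun j => joint (Function.update (fun _ => σ) i τ j))
    (ρ := joint σ) (fun j hj => by simp [hj])
    (R := {q | netTruncated c q.2 ≤ netTruncated c q.1})
    (measurableSet_le (hw.comp measurable_snd) (hw.comp measurable_fst))
    (g := acceptablePrice c) (integrable_of_abs_le (measurable_acceptablePrice hcμ) 1
      (abs_acceptablePrice_le hμ hc hcμ))
  simp only [Function.update_self] at this
  exact this

lemma expectedProfit_le_integral (hμ : 0 < μ) (hc : 0 ≤ c) (hcμ : c ≤ μ)
    {γ : ConsumerStrategy (m + 1) μ} (hγ : IsSequentiallyRational c γ) (i : Fin (m + 1)) :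
    expectedProfit γ (Function.update (fun _ => σ) i τ) i ≤
      ∫ z, acceptablePrice c z * netCDF c σ (netTruncated c z) ^ m ∂(joint τ) := by
  have h := integral_indicator_le (σ := σ) (τ := τ) hμ hc hcμ i
  rw [expectedProfit_eq _ hμ hc hcμ hγ i, ← h.2]
  refine integral_mono_ae (integrable_price_mul_sale _ hμ hc hcμ hγ i) h.1 ?_
  filter_upwards [ae_isOptimalSale (Function.update (fun _ => σ) i τ) hc hcμ hγ i] with ω hω
  exact price_mul_sale_le hγ hω

/-- The counterpart of the upper bound, with every tie resolved against firm `i`. As a net value of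
zero need not lead to a purchase, `D` must vanish there. -/
lemma integral_le_expectedProfit (hμ : 0 < μ) (hc : 0 ≤ c) (hcμ : c ≤ μ)
    {γ : ConsumerStrategy (m + 1) μ} (hγ : IsSequentiallyRational c γ) (i : Fin (m + 1))
    {D : Offer μ × ℝ → ℝ} (hD : Measurable D) (hDa : ∀ z, D z ≤ acceptablePrice c z)
    (hD0 : ∀ z, 0 ≤ D z) (hDw : ∀ z, netTruncated c z ≤ 0 → D z = 0) :
    ∫ z, D z * netCDFLeft c σ (netTruncated c z) ^ m ∂(joint τ) ≤
      expectedProfit γ (Function.update (fun _ => σ) i τ) i := by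
  have hw := measurable_netTruncated (μ := μ) hcμ
  have h := integral_pi_indicator i (ν := fun j => joint (Function.update (fun _ => σ) i τ j))
    (ρ := joint σ) (fun j hj => by simp [hj])
    (R := {q | netTruncated c q.2 < netTruncated c q.1})
    (measurableSet_lt (hw.comp measurable_snd) (hw.comp measurable_fst))
    (g := D) (integrable_of_abs_le hD 1 (by
      filter_upwards [abs_acceptablePrice_le hμ hc hcμ] with z hz
      rw [abs_of_nonneg (hD0 z)]
      exact (hDa z).trans ((le_abs_self _).trans hz)))
  simp only [Function.update_self] at h
  rw [expectedProfit_eq _ hμ hc hcμ hγ i]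
  refine h.2.symm.trans_le (integral_mono_ae h.1 (integrable_price_mul_sale _ hμ hc hcμ hγ i) ?_)
  filter_upwards [ae_isOptimalSale (Function.update (fun _ => σ) i τ) hc hcμ hγ i] with ω hω
  have h0 : 0 ≤ price (ω i).1 * sale γ i ω := mul_nonneg (price_nonneg _) (sale_nonneg hγ i ω)
  refine Set.indicator_apply_le' (fun hmem => ?_) fun _ => h0
  rcases le_or_gt (netTruncated c (ω i)) 0 with h1 | h1
  · rw [hDw _ h1]; exact h0
  · rw [hω.2 h1 hmem, mul_one]
    refine (hDa _).trans ?_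
    exact Set.indicator_apply_le' (fun _ => le_rfl) fun _ => price_nonneg _

end Profit

/-! ### Bounds on profits -/

section Bounds

variable {m : ℕ} {μ c : ℝ} {σ τ : Measure (Offer μ)}

lemma netCDF_nonneg (t : ℝ) : 0 ≤ netCDF c σ t := measureReal_nonneg

lemma acceptablePrice_of_nonneg {z : Offer μ × ℝ} (h : 0 ≤ netTruncated c z) :
    acceptablePrice c z = price z.1 :=
  Set.indicator_of_mem (s := {z | 0 ≤ netTruncated c z}) h _

lemma acceptablePrice_of_neg {z : Offer μ × ℝ} (h : netTruncated c z < 0) :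
    acceptablePrice c z = 0 :=
  Set.indicator_of_notMem (s := {z | 0 ≤ netTruncated c z}) (not_le.2 h) _

/-- The core estimate. The hypothesis at `t = W - p` bounds the winning probability by `π / (μ (Ū -
W + p))`, and multiplying by `p` gives at most `π W / (μ Ū)`. -/
lemma acceptablePrice_mul_le (hμ : 0 < μ) (hc : 0 ≤ c) (hcμ : c < μ) {π : ℝ}
    (h : ∀ t, 0 ≤ t → t < maxReservation μ c →
      netCDF c σ t ^ m * (μ * (maxReservation μ c - t)) ≤ π)
    {z : Offer μ × ℝ} (hz : 0 ≤ truncated c z) :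
    acceptablePrice c z * netCDF c σ (netTruncated c z) ^ m ≤
      π / (μ * maxReservation μ c) * truncated c z := by
  have hU := maxReservation_pos hμ hcμ
  have hπ : 0 ≤ π := le_trans (mul_nonneg (pow_nonneg (netCDF_nonneg 0) m)
    (mul_nonneg hμ.le (by linarith))) (h 0 le_rfl hU)
  have hWU := truncated_le hμ hc hcμ.le z
  rcases lt_or_ge (netTruncated c z) 0 with hw | hw
  · rw [acceptablePrice_of_neg hw, zero_mul]
    positivity
  rw [acceptablePrice_of_nonneg hw]
  rcases (price_nonneg z.1).eq_or_lt with hp | hp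
  · rw [← hp, zero_mul]; positivity
  have hb := h _ hw (by rw [netTruncated]; linarith)
  simp only [netTruncated] at hw hb ⊢
  set W := truncated c z
  set p := price z.1
  set U := maxReservation μ c
  set g := netCDF c σ (W - p) ^ m
  rw [div_mul_eq_mul_div, le_div_iff₀ (by positivity)]
  have hd : 0 < U - (W - p) := by linarith
  -- The difference of the two sides is `(W - p) * (U - W)`.
  have h1 : p * U ≤ W * (U - (W - p)) := by nlinarith
  have h2 : (p * g * (μ * U)) * (U - (W - p)) ≤ (π * W) * (U - (W - p)) := by
    calc (p * g * (μ * U)) * (U - (W - p)) = (g * (μ * (U - (W - p)))) * (p * U) := by ring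
      _ ≤ π * (W * (U - (W - p))) := mul_le_mul hb h1 (by positivity) hπ
      _ = _ := by ring
  exact le_of_mul_le_mul_right h2 hd

/-- The equality case of the core estimate: unless `W = 0`, the product `(W - p) (Ū - W)` must
vanish. -/
lemma of_acceptablePrice_mul_eq (hμ : 0 < μ) (hc : 0 ≤ c) (hcμ : c < μ) {π : ℝ} (hπ : 0 < π)
    (h : ∀ t, 0 ≤ t → t < maxReservation μ c →
      netCDF c σ t ^ m * (μ * (maxReservation μ c - t)) ≤ π)
    {z : Offer μ × ℝ} (hz : 0 ≤ truncated c z)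
    (he : acceptablePrice c z * netCDF c σ (netTruncated c z) ^ m =
      π / (μ * maxReservation μ c) * truncated c z) :
    truncated c z = 0 ∨ (0 < price z.1 ∧ 0 ≤ netTruncated c z ∧
      (netTruncated c z = 0 ∨ truncated c z = maxReservation μ c)) := by
  have hU := maxReservation_pos hμ hcμ
  have hWU := truncated_le hμ hc hcμ.le z
  rcases hz.eq_or_lt with hW | hW
  · exact Or.inl hW.symm
  right
  have hpos : 0 < π / (μ * maxReservation μ c) * truncated c z := by positivity
  rcases lt_or_ge (netTruncated c z) 0 with hw | hw
  · rw [acceptablePrice_of_neg hw, zero_mul] at he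
    linarith
  rw [acceptablePrice_of_nonneg hw] at he
  rcases (price_nonneg z.1).eq_or_lt with hp | hp
  · rw [← hp, zero_mul] at he; linarith
  refine ⟨hp, hw, ?_⟩
  have hb := h _ hw (by rw [netTruncated]; linarith)
  simp only [netTruncated] at hw hb he ⊢
  set W := truncated c z
  set p := price z.1
  set U := maxReservation μ c
  set g := netCDF c σ (W - p) ^ m
  rw [div_mul_eq_mul_div, eq_div_iff (by positivity)] at he
  have h1 : π * (W * (U - (W - p))) ≤ π * (p * U) := by
    calc π * (W * (U - (W - p))) = (π * W) * (U - (W - p)) := by ring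
      _ = (g * (μ * (U - (W - p)))) * (p * U) := by rw [← he]; ring
      _ ≤ π * (p * U) := mul_le_mul_of_nonneg_right hb (by positivity)
  have h2 : W * (U - (W - p)) ≤ p * U := le_of_mul_le_mul_left h1 hπ
  have h3 : (W - p) * (U - W) = 0 := le_antisymm (by nlinarith)
    (mul_nonneg hw (by linarith))
  rcases mul_eq_zero.1 h3 with h | h
  · exact Or.inl h
  · right; linarith

lemma truncated_one (hμ : 0 < μ) (hc : 0 ≤ c) (hcμ : c < μ) (hμ1 : μ ≤ 1) {a : Offer μ}
    (ha : signal a = fullInformation μ) : truncated c (a, 1) = maxReservation μ c := by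
  rw [truncated, reservation_fullInformation hμ hc hcμ.le hμ1 ha]
  exact min_eq_right (maxReservation_le_one hμ hc)

/-- The price of an offer whose realized net value is positive, and `0` for others. -/
def winningPrice (c : ℝ) (z : Offer μ × ℝ) : ℝ :=
  {z | 0 < netTruncated c z}.indicator (fun z => price z.1) z

lemma measurable_winningPrice (hcμ : c ≤ μ) :
    Measurable (winningPrice c : Offer μ × ℝ → ℝ) :=
  (measurable_price.comp measurable_fst).indicator
    (measurableSet_lt measurable_const (measurable_netTruncated hcμ))

lemma winningPrice_nonneg (z : Offer μ × ℝ) : 0 ≤ winningPrice c z :=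
  Set.indicator_nonneg (fun z _ => price_nonneg z.1) z

lemma winningPrice_le (z : Offer μ × ℝ) : winningPrice c z ≤ acceptablePrice c z :=
  Set.indicator_le_indicator_of_subset (s := {z | 0 < netTruncated c z})
    (t := {z | 0 ≤ netTruncated c z}) (fun z (h : 0 < netTruncated c z) =>
      show 0 ≤ netTruncated c z from h.le) (fun z => price_nonneg z.1) z

lemma le_integral_winningPrice_fullInformation (hμ : 0 < μ) (hc : 0 ≤ c) (hcμ : c < μ)
    (hμ1 : μ ≤ 1) {a : Offer μ} (ha : signal a = fullInformation μ)
    (hp : price a < maxReservation μ c) :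
    μ * (price a * netCDFLeft c σ (maxReservation μ c - price a) ^ m) ≤
      ∫ x, winningPrice c (a, x) * netCDFLeft c σ (netTruncated c (a, x)) ^ m ∂(signal a) := by
  rw [ha, integral_fullInformation hμ.le hμ1]
  have h1 : netTruncated c (a, 1) = maxReservation μ c - price a := by
    rw [netTruncated, truncated_one hμ hc hcμ hμ1 ha]
  have h2 : winningPrice c (a, 1) = price a :=
    Set.indicator_of_mem (s := {z | 0 < netTruncated c z})
      (show 0 < netTruncated c (a, 1) by rw [h1]; linarith) _
  rw [h1, h2]
  have : 0 ≤ (1 - μ) * (winningPrice c (a, 0) *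
      netCDFLeft c σ (netTruncated c (a, 0)) ^ m) :=
    mul_nonneg (by linarith) (mul_nonneg (winningPrice_nonneg _)
      (pow_nonneg measureReal_nonneg m))
  linarith

variable [IsProbabilityMeasure σ] [IsProbabilityMeasure τ]

lemma netCDF_mono : Monotone (netCDF c σ) := fun _ _ h =>
  measureReal_mono fun _ hz => le_trans hz h

lemma netCDFLeft_mono : Monotone (netCDFLeft c σ) := fun _ _ h =>
  measureReal_mono fun _ hz => lt_of_lt_of_le hz h

lemma netCDF_le_netCDFLeft {s t : ℝ} (h : s < t) : netCDF c σ s ≤ netCDFLeft c σ t :=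
  measureReal_mono fun _ hz => lt_of_le_of_lt hz h

lemma netCDFLeft_le_one (t : ℝ) : netCDFLeft c σ t ≤ 1 := measureReal_le_one

lemma netCDF_le_one (t : ℝ) : netCDF c σ t ≤ 1 := measureReal_le_one

/-- Linearity in `W` pays off here: the mean does not depend on the deviation `τ`. -/
lemma integral_truncated_scaled (hμ : 0 < μ) (hc : 0 ≤ c) (hcμ : c < μ) (π : ℝ) :
    ∫ z, π / (μ * maxReservation μ c) * truncated c z ∂(joint τ) = π := by
  rw [integral_const_mul, integral_truncated_joint hμ hc hcμ.le, mul_maxReservation hμ]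
  exact div_mul_cancel₀ _ (by linarith)

lemma integrable_acceptablePrice_mul (hμ : 0 < μ) (hc : 0 ≤ c) (hcμ : c < μ) :
    Integrable (fun z => acceptablePrice c z * netCDF c σ (netTruncated c z) ^ m)
      (joint τ) := by
  refine integrable_of_abs_le ((measurable_acceptablePrice hcμ.le).mul
    ((netCDF_mono.measurable.comp (measurable_netTruncated hcμ.le)).pow_const m)) 1 ?_
  filter_upwards [abs_acceptablePrice_le hμ hc hcμ.le] with z hz
  rw [abs_mul, abs_of_nonneg (pow_nonneg (netCDF_nonneg _) m)]
  exact mul_le_one₀ hz (pow_nonneg (netCDF_nonneg _) m)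
    (pow_le_one₀ (netCDF_nonneg _) (netCDF_le_one _))

lemma integral_acceptablePrice_mul_le (hμ : 0 < μ) (hc : 0 ≤ c) (hcμ : c < μ) {π : ℝ}
    (h : ∀ t, 0 ≤ t → t < maxReservation μ c →
      netCDF c σ t ^ m * (μ * (maxReservation μ c - t)) ≤ π) :
    ∫ z, acceptablePrice c z * netCDF c σ (netTruncated c z) ^ m ∂(joint τ) ≤ π := by
  rw [← integral_truncated_scaled (τ := τ) hμ hc hcμ π]
  refine integral_mono_ae (integrable_acceptablePrice_mul hμ hc hcμ)
    ((integrable_truncated_joint hμ hc hcμ.le).const_mul _) ?_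
  filter_upwards [ae_truncated_nonneg hcμ.le] with z hz
  exact acceptablePrice_mul_le hμ hc hcμ h hz

/-- No offer earns more than `π` if the distribution of net values obeys the bound that keeps
fully revealing offers from earning more than `π`. -/
theorem expectedProfit_le (hμ : 0 < μ) (hc : 0 ≤ c) (hcμ : c < μ) {π : ℝ}
    (h : ∀ t, 0 ≤ t → t < maxReservation μ c →
      netCDF c σ t ^ m * (μ * (maxReservation μ c - t)) ≤ π)
    {γ : ConsumerStrategy (m + 1) μ} (hγ : IsSequentiallyRational c γ) (i : Fin (m + 1)) :
    expectedProfit γ (Function.update (fun _ => σ) i τ) i ≤ π :=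
  (expectedProfit_le_integral hμ hc hcμ.le hγ i).trans
    (integral_acceptablePrice_mul_le hμ hc hcμ h)

lemma integral_joint {f : Offer μ × ℝ → ℝ} (hf : Integrable f (joint τ)) :
    ∫ z, f z ∂(joint τ) = ∫ a, ∫ x, f (a, x) ∂(signal a) ∂τ :=
  Measure.integral_compProd hf

lemma integral_joint_dirac {f : Offer μ × ℝ → ℝ} (hf : Measurable f) (a : Offer μ)
    (hI : Integrable f (joint (Measure.dirac a))) :
    ∫ z, f z ∂(joint (Measure.dirac a)) = ∫ x, f (a, x) ∂(signal a) := by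
  rw [integral_joint hI]
  exact integral_dirac' (fun a => ∫ x, f (a, x) ∂(signal a)) a
    (StronglyMeasurable.integral_kernel_prod_right' (κ := signalKernel μ) hf.stronglyMeasurable)

lemma measurable_winningPrice_mul (hcμ : c ≤ μ) :
    Measurable fun z : Offer μ × ℝ => winningPrice c z * netCDFLeft c σ (netTruncated c z) ^ m :=
  (measurable_winningPrice hcμ).mul
    ((netCDFLeft_mono.measurable.comp (measurable_netTruncated hcμ)).pow_const m)

lemma integrable_winningPrice_mul (hμ : 0 < μ) (hc : 0 ≤ c) (hcμ : c < μ) :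
    Integrable (fun z => winningPrice c z * netCDFLeft c σ (netTruncated c z) ^ m)
      (joint τ) := by
  refine integrable_of_abs_le (measurable_winningPrice_mul hcμ.le) 1 ?_
  filter_upwards [abs_acceptablePrice_le hμ hc hcμ.le] with z hz
  have h0 : 0 ≤ netCDFLeft c σ (netTruncated c z) := measureReal_nonneg
  rw [abs_mul, abs_of_nonneg (pow_nonneg h0 m), abs_of_nonneg (winningPrice_nonneg z)]
  exact mul_le_one₀ ((winningPrice_le z).trans ((le_abs_self _).trans hz)) (pow_nonneg h0 m)
    (pow_le_one₀ h0 (netCDFLeft_le_one _))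

lemma integral_winningPrice_le (hμ : 0 < μ) (hc : 0 ≤ c) (hcμ : c < μ)
    {γ : ConsumerStrategy (m + 1) μ} (hγ : IsSequentiallyRational c γ) (i : Fin (m + 1)) :
    ∫ z, winningPrice c z * netCDFLeft c σ (netTruncated c z) ^ m ∂(joint τ) ≤
      expectedProfit γ (Function.update (fun _ => σ) i τ) i :=
  integral_le_expectedProfit hμ hc hcμ.le hγ i (measurable_winningPrice hcμ.le) winningPrice_le
    winningPrice_nonneg fun _ hz => Set.indicator_of_notMem (by simpa using hz) _

theorem le_expectedProfit_fullOffer (hμ : 0 < μ) (hc : 0 ≤ c) (hcμ : c < μ) (hμ1 : μ ≤ 1)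
    {γ : ConsumerStrategy (m + 1) μ} (hγ : IsSequentiallyRational c γ) (i : Fin (m + 1))
    (p : ℝ≥0) (hp : p < maxReservation μ c) :
    μ * (p * netCDFLeft c σ (maxReservation μ c - p) ^ m) ≤
      expectedProfit γ (Function.update (fun _ => σ) i
        (Measure.dirac (fullOffer hμ.le hμ1 p))) i := by
  refine le_trans ?_ (integral_winningPrice_le hμ hc hcμ hγ i)
  rw [integral_joint_dirac (measurable_winningPrice_mul hcμ.le) _
    (integrable_winningPrice_mul hμ hc hcμ)]
  exact le_integral_winningPrice_fullInformation (a := fullOffer hμ.le hμ1 p) hμ hc hcμ hμ1 rfl hp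

end Bounds

/-! ### Necessary conditions for an equilibrium -/

section Necessary

variable {m : ℕ} {μ c : ℝ} {σ : Measure (Offer μ)} {γ : ConsumerStrategy (m + 1) μ}

lemma update_self_const (i : Fin (m + 1)) :
    Function.update (fun _ : Fin (m + 1) => σ) i σ = fun _ => σ := by
  funext j; by_cases h : j = i <;> simp [Function.update, h]

/-- The deviation is full information at price `Ū - s` with `s` slightly above `t`. It beats rivals
with net value up to `t` strictly, so the consumer's handling of ties does not matter; then `s`
tends to `t`. -/
lemma IsSymmetricEquilibrium.netCDF_pow_le (h : IsSymmetricEquilibrium (m + 1) c σ γ)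
    (hμ : 0 < μ) (hc : 0 ≤ c) (hcμ : c < μ) (hμ1 : μ ≤ 1) (i : Fin (m + 1)) {t : ℝ}
    (ht0 : 0 ≤ t) (ht : t < maxReservation μ c) :
    netCDF c σ t ^ m * (μ * (maxReservation μ c - t)) ≤ expectedProfit γ (fun _ => σ) i := by
  have := h.isProbabilityMeasure
  have hlim : Filter.Tendsto (fun s => netCDF c σ t ^ m * (μ * (maxReservation μ c - s)))
      (nhdsWithin t (Set.Ioi t)) (nhds (netCDF c σ t ^ m * (μ * (maxReservation μ c - t)))) :=
    (Continuous.tendsto (by fun_prop) t).mono_left nhdsWithin_le_nhds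
  refine le_of_tendsto hlim ?_
  filter_upwards [Ioo_mem_nhdsGT ht] with s hs
  set p : ℝ≥0 := ⟨maxReservation μ c - s, by linarith [hs.2]⟩ with hp
  have hpc : (p : ℝ) = maxReservation μ c - s := rfl
  have h1 := le_expectedProfit_fullOffer (σ := σ) hμ hc hcμ hμ1 h.sequentiallyRational i p
    (by rw [hpc]; linarith [hs.1])
  have h2 := h1.trans (h.noDeviation i _ inferInstance)
  refine le_trans ?_ h2
  rw [hpc, sub_sub_cancel]
  have h3 : netCDF c σ t ^ m ≤ netCDFLeft c σ s ^ m :=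
    pow_le_pow_left₀ (netCDF_nonneg t) (netCDF_le_netCDFLeft hs.1) m
  have h4 : 0 ≤ μ * (maxReservation μ c - s) := mul_nonneg hμ.le (by linarith [hs.2])
  nlinarith [mul_le_mul_of_nonneg_right h3 h4]

/-- The truncated posterior has mean `μ Ū`, so net values cannot almost surely exceed that level. A
fully revealing offer leaving the net value `μ Ū < Ū` then has a positive price and wins with
positive probability. -/
lemma IsSymmetricEquilibrium.expectedProfit_pos (h : IsSymmetricEquilibrium (m + 1) c σ γ)
    (hμ : 0 < μ) (hc : 0 ≤ c) (hcμ : c < μ) (hμ1 : μ < 1) (i : Fin (m + 1)) :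
    0 < expectedProfit γ (fun _ => σ) i := by
  have := h.isProbabilityMeasure
  have hU := maxReservation_pos hμ hcμ
  have hlt : μ * maxReservation μ c < maxReservation μ c := by nlinarith
  refine lt_of_lt_of_le ?_ (h.netCDF_pow_le hμ hc hcμ hμ1.le i
    (t := μ * maxReservation μ c) (by positivity) hlt)
  refine mul_pos (pow_pos ?_ m) (mul_pos hμ (by linarith))
  refine lt_of_le_of_ne (netCDF_nonneg _) fun h0 => ?_
  have hnull : joint σ {z | netTruncated c z ≤ μ * maxReservation μ c} = 0 :=
    (measureReal_eq_zero_iff).1 h0.symm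
  have hae : ∀ᵐ z ∂(joint σ), 0 < truncated c z - μ * maxReservation μ c := by
    filter_upwards [measure_eq_zero_iff_ae_notMem.1 hnull] with z hz
    have hz' : μ * maxReservation μ c < netTruncated c z := not_le.1 hz
    rw [netTruncated] at hz'
    linarith [price_nonneg z.1]
  have hI := (integrable_truncated_joint (σ := σ) hμ hc hcμ.le).sub
    (integrable_const (μ * maxReservation μ c))
  have hzero : ∫ z, (truncated c z - μ * maxReservation μ c) ∂(joint σ) = 0 := by
    rw [integral_sub (integrable_truncated_joint hμ hc hcμ.le) (integrable_const _),
      integral_truncated_joint hμ hc hcμ.le, mul_maxReservation hμ]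
    simp
  have hz := (integral_eq_zero_iff_of_nonneg_ae (hae.mono fun z hz => hz.le) hI).1 hzero
  have hfalse : ∀ᵐ _ ∂(joint σ), False := by
    filter_upwards [hae, hz] with z h1 h2
    simp only [Pi.zero_apply] at h2
    linarith
  rw [Filter.eventually_false_iff_eq_bot, ae_eq_bot] at hfalse
  exact IsProbabilityMeasure.ne_zero _ hfalse

/-- The equilibrium profit is at most the revenue with ties won, which is at most the mean of the
linear bound, which is that profit again. So both pointwise inequalities hold with equality almost
surely. -/
theorem IsSymmetricEquilibrium.ae_eq (h : IsSymmetricEquilibrium (m + 1) c σ γ)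
    (hμ : 0 < μ) (hc : 0 ≤ c) (hcμ : c < μ) (hμ1 : μ ≤ 1) (i : Fin (m + 1)) :
    (∀ᵐ ω ∂(Measure.pi fun _ => joint σ), price (ω i).1 * sale γ i ω =
      {ω : Fin (m + 1) → Offer μ × ℝ | ∀ j, j ≠ i →
        netTruncated c (ω j) ≤ netTruncated c (ω i)}.indicator
          (fun ω => acceptablePrice c (ω i)) ω) ∧
    ∀ᵐ z ∂(joint σ), acceptablePrice c z * netCDF c σ (netTruncated c z) ^ m =
      expectedProfit γ (fun _ => σ) i / (μ * maxReservation μ c) * truncated c z := by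
  have := h.isProbabilityMeasure
  have hγ := h.sequentiallyRational
  have h1 := integral_indicator_le (σ := σ) (τ := σ) hμ hc hcμ.le i
  simp only [update_self_const] at h1
  have h2 := integral_acceptablePrice_mul_le (τ := σ) hμ hc hcμ
    fun t => h.netCDF_pow_le (t := t) hμ hc hcμ hμ1 i
  have h3 := expectedProfit_eq (fun _ : Fin (m + 1) => σ) hμ hc hcμ.le hγ i
  have hle : ∀ᵐ ω ∂(Measure.pi fun _ => joint σ), price (ω i).1 * sale γ i ω ≤
      {ω : Fin (m + 1) → Offer μ × ℝ | ∀ j, j ≠ i →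
        netTruncated c (ω j) ≤ netTruncated c (ω i)}.indicator
          (fun ω => acceptablePrice c (ω i)) ω := by
    filter_upwards [ae_isOptimalSale (fun _ => σ) hc hcμ.le hγ i] with ω hω
    exact price_mul_sale_le hγ hω
  have hI := integrable_price_mul_sale (fun _ : Fin (m + 1) => σ) hμ hc hcμ.le hγ i
  have h4 := integral_mono_ae hI h1.1 hle
  rw [← h3, h1.2] at h4
  refine ⟨(integral_eq_iff_of_ae_le hI h1.1 hle).1 ?_,
    (integral_eq_iff_of_ae_le (integrable_acceptablePrice_mul hμ hc hcμ)
      ((integrable_truncated_joint hμ hc hcμ.le).const_mul _) ?_).1 ?_⟩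
  · rw [← h3, h1.2]; exact le_antisymm h4 h2
  · filter_upwards [ae_truncated_nonneg hcμ.le] with z hz
    exact acceptablePrice_mul_le hμ hc hcμ (fun t => h.netCDF_pow_le hμ hc hcμ hμ1 i) hz
  · rw [integral_truncated_scaled hμ hc hcμ]; exact le_antisymm h2 h4

/-- At price zero the tight bound forces the truncated posterior to vanish almost surely, against
its mean `μ - c > 0`. -/
lemma IsSymmetricEquilibrium.ae_price_pos (h : IsSymmetricEquilibrium (m + 1) c σ γ)
    (hμ : 0 < μ) (hc : 0 ≤ c) (hcμ : c < μ) (hμ1 : μ < 1) : ∀ᵐ a ∂σ, 0 < price a := by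
  have := h.isProbabilityMeasure
  have hU := maxReservation_pos hμ hcμ
  have hπ := h.expectedProfit_pos hμ hc hcμ hμ1 0
  filter_upwards [Measure.ae_ae_of_ae_compProd (h.ae_eq hμ hc hcμ hμ1.le 0).2] with a ha
  refine lt_of_le_of_ne (price_nonneg a) fun hp => ?_
  have hW : ∀ᵐ x ∂(signal a), truncated c (a, x) = 0 := by
    filter_upwards [ha] with x hx
    have : acceptablePrice c (a, x) = 0 := Set.indicator_apply_eq_zero.2 fun _ => hp.symm
    rw [this, zero_mul] at hx
    exact (mul_eq_zero.1 hx.symm).resolve_left (by positivity)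
  have := integral_truncated hc hcμ.le a
  rw [integral_congr_ae hW] at this
  simp only [integral_zero] at this
  linarith

/-- Since the consumer can buy from one firm only, ties between all firms have probability
zero. -/
theorem IsSymmetricEquilibrium.joint_netTruncated_eq (h : IsSymmetricEquilibrium (m + 1) c σ γ)
    (hm : 1 ≤ m) (hμ : 0 < μ) (hc : 0 ≤ c) (hcμ : c < μ) (hμ1 : μ < 1) {t : ℝ} (ht : 0 ≤ t) :
    joint σ {z | netTruncated c z = t} = 0 := by
  have := h.isProbabilityMeasure
  have hpos : ∀ᵐ z ∂(joint σ), 0 < price z.1 :=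
    Measure.ae_compProd_of_ae_fst _ (measurableSet_lt measurable_const measurable_price)
      (h.ae_price_pos hμ hc hcμ hμ1)
  have hae : ∀ᵐ ω ∂(Measure.pi fun _ : Fin (m + 1) => joint σ),
      ω ∉ Set.univ.pi fun _ => {z | netTruncated c z = t} := by
    filter_upwards [ae_all_iff.2 fun i => (h.ae_eq hμ hc hcμ hμ1.le i).1,
      ae_all_iff.2 fun i => ae_eval (ρ := fun _ : Fin (m + 1) => joint σ) i hpos]
      with ω h1 h2 hω
    have hw : ∀ i, netTruncated c (ω i) = t := fun i => hω i (Set.mem_univ i)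
    -- When all firms tie, tightness says that each of them earns its full positive price, so all `m
    -- + 1 ≥ 2` sell with certainty.
    have hs : ∀ i, sale γ i ω = 1 := by
      intro i
      have e := h1 i
      rw [Set.indicator_of_mem (by intro j _; rw [hw i, hw j]),
        acceptablePrice_of_nonneg ((hw i).symm ▸ ht)] at e
      exact mul_left_cancel₀ (h2 i).ne' (by rw [e, mul_one])
    have := sum_sale_le_one h.sequentiallyRational ω
    simp only [hs, Finset.sum_const, Finset.card_univ, Fintype.card_fin, nsmul_eq_mul,
      mul_one] at this
    have hm' : (1 : ℝ) ≤ m := by exact_mod_cast hm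
    push_cast at this
    linarith
  have h0 := measure_eq_zero_iff_ae_notMem.2 hae
  -- By independence the null event has as its probability a power of the mass of the atom.
  rw [Measure.pi_pi] at h0
  simpa using h0

/-- In equilibrium, offers are fully revealing, and prices satisfy the indifference condition. -/
theorem IsSymmetricEquilibrium.ae_fullInformation (h : IsSymmetricEquilibrium (m + 1) c σ γ)
    (hm : 1 ≤ m) (hμ : 0 < μ) (hc : 0 ≤ c) (hcμ : c < μ) (hμ1 : μ < 1) (i : Fin (m + 1)) :
    ∀ᵐ a ∂σ, signal a = fullInformation μ ∧ 0 < price a ∧ price a ≤ maxReservation μ c ∧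
      price a * netCDF c σ (maxReservation μ c - price a) ^ m =
        expectedProfit γ (fun _ => σ) i / μ := by
  have := h.isProbabilityMeasure
  have hU := maxReservation_pos hμ hcμ
  have hπ := h.expectedProfit_pos hμ hc hcμ hμ1 i
  have hae : ∀ᵐ z ∂(joint σ),
      acceptablePrice c z * netCDF c σ (netTruncated c z) ^ m =
      expectedProfit γ (fun _ => σ) i / (μ * maxReservation μ c) * truncated c z ∧
      (truncated c z = 0 ∨ truncated c z = maxReservation μ c ∧ 0 ≤ netTruncated c z) := by
    filter_upwards [(h.ae_eq hμ hc hcμ hμ1.le i).2, ae_truncated_nonneg hcμ.le,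
      measure_eq_zero_iff_ae_notMem.1 (h.joint_netTruncated_eq hm hμ hc hcμ hμ1 le_rfl)]
      with z h1 h2 h3
    refine ⟨h1, ?_⟩
    rcases of_acceptablePrice_mul_eq hμ hc hcμ hπ
      (fun t => h.netCDF_pow_le hμ hc hcμ hμ1.le i) h2 h1 with h4 | ⟨_, h5, h6 | h6⟩
    · exact Or.inl h4
    · exact absurd h6 h3
    · exact Or.inr ⟨h6, h5⟩
  filter_upwards [Measure.ae_ae_of_ae_compProd hae, h.ae_price_pos hμ hc hcμ hμ1] with a ha hp
  have hFI := signal_eq_fullInformation hμ hc hcμ a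
    (by filter_upwards [ha] with x hx; exact hx.2.imp_right And.left)
  have hone : ∀ᵐ x ∂(Measure.dirac (1 : ℝ)), acceptablePrice c (a, x) *
      netCDF c σ (netTruncated c (a, x)) ^ m =
      expectedProfit γ (fun _ => σ) i / (μ * maxReservation μ c) * truncated c (a, x) ∧
      (truncated c (a, x) = 0 ∨ truncated c (a, x) = maxReservation μ c ∧
        0 ≤ netTruncated c (a, x)) := by
    -- Full information has an atom at `1`, so almost sure statements hold at the posterior `1`
    -- itself.
    have hac : Measure.dirac (1 : ℝ) ≪ signal a := by
      rw [hFI]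
      refine Measure.AbsolutelyContinuous.mk fun s hs h0 => ?_
      rw [fullInformation, Measure.add_apply, add_eq_zero, Measure.smul_apply,
        Measure.smul_apply, smul_eq_mul, smul_eq_mul, mul_eq_zero, mul_eq_zero] at h0
      exact h0.2.resolve_left (by simpa using hμ)
    exact hac.ae_le ha
  rw [ae_dirac_eq] at hone
  obtain ⟨h1, h2⟩ := hone
  have hW := truncated_one hμ hc hcμ hμ1.le hFI
  have hw : 0 ≤ netTruncated c (a, 1) := by
    rcases h2 with h2 | h2
    · rw [h2] at hW; linarith
    · exact h2.2
  rw [acceptablePrice_of_nonneg hw, hW, netTruncated, hW] at h1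
  rw [netTruncated, hW] at hw
  refine ⟨hFI, hp, by simpa using hw, ?_⟩
  refine h1.trans ?_
  field_simp

end Necessary

/-! ### The distribution of prices -/

section CDF

variable {Q : Measure ℝ} [IsProbabilityMeasure Q]

lemma continuous_real_Iic (hQ : ∀ p, Q {p} = 0) : Continuous fun p => Q.real (Set.Iic p) := by
  have e : (fun p => Q.real (Set.Iic p)) = cdf Q := by
    funext p; rw [cdf_eq_real]
  rw [e, continuous_iff_continuousAt]
  intro p
  rw [(monotone_cdf Q).continuousAt_iff_leftLim_eq_rightLim, StieltjesFunction.rightLim_eq]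
  refine le_antisymm ((monotone_cdf Q).leftLim_le le_rfl) ?_
  have h := hQ p
  rw [← measure_cdf Q, StieltjesFunction.measure_singleton, ENNReal.ofReal_eq_zero] at h
  linarith

/-- The distribution function of an atomless law is uniformly distributed. -/
lemma real_setOf_real_Iic_le (hQ : ∀ p, Q {p} = 0) {a b : ℝ} (hab : a ≤ b)
    (ha : Q.real (Set.Iic a) = 0) (hb : Q.real (Set.Iic b) = 1) {s : ℝ} (hs0 : 0 ≤ s)
    (hs1 : s ≤ 1) : Q.real {p | Q.real (Set.Iic p) ≤ s} = s := by
  -- A continuous distribution function attains every level; sublevel sets are then squeezed between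
  -- half-lines of known mass.
  have hivt : ∀ t, 0 ≤ t → t ≤ 1 → ∃ p, Q.real (Set.Iic p) = t := fun t h0 h1 => by
    obtain ⟨p, -, hp⟩ := intermediate_value_Icc hab (continuous_real_Iic hQ).continuousOn
      (show t ∈ Set.Icc (Q.real (Set.Iic a)) (Q.real (Set.Iic b)) by rw [ha, hb]; exact ⟨h0, h1⟩)
    exact ⟨p, hp⟩
  refine le_antisymm ?_ ?_
  · rcases hs1.eq_or_lt with h | h
    · rw [h]; exact measureReal_le_one
    refine le_of_forall_gt_imp_ge_of_dense fun t ht => ?_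
    rcases le_or_gt 1 t with h1 | h1
    · exact measureReal_le_one.trans h1
    obtain ⟨p, hp⟩ := hivt t (by linarith) h1.le
    rw [← hp]
    refine measureReal_mono fun x (hx : Q.real (Set.Iic x) ≤ s) => ?_
    by_contra hxp
    have := measureReal_mono (μ := Q) (Set.Iic_subset_Iic.2 (not_le.1 hxp).le)
    linarith
  · obtain ⟨p, hp⟩ := hivt s hs0 hs1
    conv_lhs => rw [← hp]
    exact measureReal_mono fun x (hx : x ≤ p) =>
      (measureReal_mono (Set.Iic_subset_Iic.2 hx)).trans hp.le

/-- The equilibrium distribution function of prices. -/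
def priceCDF (μ U : ℝ) (m : ℕ) (p : ℝ) : ℝ :=
  1 / μ - (1 - μ) / μ * (U / p) ^ (1 / (m : ℝ))

lemma priceCDF_lower {μ U : ℝ} {m : ℕ} (hm : 1 ≤ m) (hμ : 0 < μ) (hμ1 : μ < 1) (hU : 0 < U) :
    priceCDF μ U m ((1 - μ) ^ m * U) = 0 := by
  have h1 : 0 < 1 - μ := by linarith
  have hm' : m ≠ 0 := by omega
  have e : U / ((1 - μ) ^ m * U) = ((1 - μ)⁻¹) ^ m := by
    rw [inv_pow]; field_simp
  rw [priceCDF, e, one_div (m : ℝ), Real.pow_rpow_inv_natCast (by positivity) hm']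
  field_simp
  ring

lemma priceCDF_upper {μ U : ℝ} {m : ℕ} (hμ : 0 < μ) (hU : 0 < U) :
    priceCDF μ U m U = 1 := by
  rw [priceCDF, div_self hU.ne', Real.one_rpow]
  field_simp
  ring

lemma priceCDF_mono {μ U : ℝ} {m : ℕ} (hμ : 0 < μ) (hμ1 : μ < 1) (hU : 0 < U) {p q : ℝ}
    (hp : 0 < p) (hpq : p ≤ q) : priceCDF μ U m p ≤ priceCDF μ U m q := by
  have h1 : 0 ≤ (1 - μ) / μ := div_nonneg (by linarith) hμ.le
  have hq : 0 < q := hp.trans_le hpq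
  have h2 : (U / q) ^ (1 / (m : ℝ)) ≤ (U / p) ^ (1 / (m : ℝ)) :=
    Real.rpow_le_rpow (by positivity) (div_le_div_of_nonneg_left hU.le hp hpq) (by positivity)
  rw [priceCDF, priceCDF]
  linarith [mul_le_mul_of_nonneg_left h2 h1]

/-- The indifference condition determines the distribution of prices. -/
theorem real_Iic_eq_priceCDF {μ U K : ℝ} {m : ℕ} (hm : 1 ≤ m) (hμ : 0 < μ) (hμ1 : μ < 1)
    (hU : 0 < U) (hQ : ∀ p, Q {p} = 0) (hsupp : ∀ᵐ p ∂Q, 0 < p ∧ p ≤ U) (hK : 0 < K)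
    (hle : ∀ p, 0 < p → p ≤ U → p * (1 - μ * Q.real (Set.Iic p)) ^ m ≤ K)
    (heq : ∀ᵐ p ∂Q, p * (1 - μ * Q.real (Set.Iic p)) ^ m = K) {p : ℝ}
    (hp : p ∈ Set.Icc ((1 - μ) ^ m * U) U) : Q.real (Set.Iic p) = priceCDF μ U m p := by
  have hm' : m ≠ 0 := by omega
  have hmR : (0 : ℝ) < m := by exact_mod_cast (by omega : 0 < m)
  set q : ℝ → ℝ := fun p => Q.real (Set.Iic p) with hq
  have hq0 : ∀ p, 0 ≤ q p := fun p => measureReal_nonneg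
  have hq1 : ∀ p, q p ≤ 1 := fun p => measureReal_le_one
  -- `g p` is the value `v` that solves `p * (1 - μ * v) ^ m = K`. The distribution function `q`
  -- lies above `g` on `(0, U]` and equals it almost surely.
  set g : ℝ → ℝ := fun p => (1 - (K / p) ^ (1 / (m : ℝ))) / μ with hg
  have hroot : ∀ p, 0 < p → ((K / p) ^ (1 / (m : ℝ))) ^ m = K / p := fun p hp => by
    rw [one_div, Real.rpow_inv_natCast_pow (by positivity) hm']
  have hroot0 : ∀ p, 0 < p → 0 ≤ (K / p) ^ (1 / (m : ℝ)) := fun p hp =>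
    Real.rpow_nonneg (by positivity) _
  have hbase : ∀ p, 0 ≤ 1 - μ * q p := fun p => by nlinarith [hq0 p, hq1 p]
  have hgle : ∀ p, 0 < p → p ≤ U → g p ≤ q p := by
    intro p hp hpU
    have h1 : (1 - μ * q p) ^ m ≤ ((K / p) ^ (1 / (m : ℝ))) ^ m := by
      rw [hroot p hp, le_div_iff₀ hp, mul_comm]; exact hle p hp hpU
    have h2 := le_of_pow_le_pow_left₀ hm' (hroot0 p hp) h1
    rw [hg]
    simp only
    rw [div_le_iff₀ hμ]
    linarith
  have hgeq : ∀ᵐ p ∂Q, q p = g p := by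
    filter_upwards [hsupp, heq] with p hp he
    have h1 : (1 - μ * q p) ^ m = ((K / p) ^ (1 / (m : ℝ))) ^ m := by
      rw [hroot p hp.1, eq_div_iff hp.1.ne', mul_comm]; exact he
    have h2 := (pow_left_inj₀ (hbase p) (hroot0 p hp.1) hm').1 h1
    rw [hg]
    simp only
    rw [eq_div_iff hμ.ne']
    linarith
  have hgmono : ∀ p p', 0 < p → 0 < p' → (p ≤ p' ↔ g p ≤ g p') := by
    intro p p' hp hp'
    rw [hg]
    simp only
    rw [div_le_div_iff_of_pos_right hμ, sub_le_sub_iff_left,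
      Real.rpow_le_rpow_iff (by positivity) (by positivity) (by positivity),
      div_le_div_iff_of_pos_left hK hp' hp]
  have hqzero : Q.real (Set.Iic 0) = 0 := by
    rw [measureReal_eq_zero_iff, measure_eq_zero_iff_ae_notMem]
    filter_upwards [hsupp] with p hp
    exact not_le.2 hp.1
  have hqU : Q.real (Set.Iic U) = 1 := by
    have : ∀ᵐ p ∂Q, p ∈ Set.Iic U := hsupp.mono fun p hp => hp.2
    rw [measureReal_def, (prob_compl_eq_zero_iff measurableSet_Iic).1 this]; rfl
  -- As `g` is strictly increasing and `q = g` almost surely, `x ≤ p` amounts to `q x ≤ g p`. Since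
  -- `q` is uniformly distributed under `Q`, this turns equality almost surely into equality at `p`.
  have hset : ∀ p, 0 < p → q p = Q.real {x | q x ≤ g p} := by
    intro p hp
    refine measureReal_congr ?_
    filter_upwards [hsupp, hgeq] with x hx hgx
    refine propext ?_
    change x ≤ p ↔ q x ≤ g p
    rw [hgx]
    exact hgmono x p hx.1 hp
  have hfix : ∀ p, 0 < p → 0 ≤ g p → g p ≤ 1 → q p = g p := fun p hp h0 h1 =>
    (hset p hp).trans (real_setOf_real_Iic_le hQ hU.le hqzero hqU h0 h1)
  have hgU1 : g U ≤ 1 := (hgle U hU le_rfl).trans (hq1 U)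
  -- A negative `g U` would give `q U = 0`. Thus `g U` lies in `[0, 1]` and equals `q U = 1`, which
  -- determines `K`.
  have hgU0 : 0 ≤ g U := by
    by_contra h
    have : q U = 0 := by
      rw [hset U hU]
      have : {x | q x ≤ g U} = ∅ := by
        ext x
        refine ⟨fun (hx : q x ≤ g U) => ?_, fun h => h.elim⟩
        linarith [hq0 x]
      rw [this]; simp
    have h1 : q U = 1 := hqU
    linarith
  have hgU : g U = 1 := (hfix U hU hgU0 hgU1).symm.trans hqU
  have hKU : K = U * (1 - μ) ^ m := by
    have h1 : (K / U) ^ (1 / (m : ℝ)) = 1 - μ := by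
      have : (1 - (K / U) ^ (1 / (m : ℝ))) / μ = 1 := hgU
      rw [div_eq_one_iff_eq hμ.ne'] at this
      linarith
    have h2 := hroot U hU
    rw [h1] at h2
    rw [h2]; field_simp
  have hlow : 0 < (1 - μ) ^ m * U := mul_pos (pow_pos (by linarith) m) hU
  have hgp : ∀ x, 0 < x → g x = priceCDF μ U m x := by
    intro x hx
    have : K / x = (1 - μ) ^ m * (U / x) := by rw [hKU]; ring
    rw [hg, priceCDF]
    simp only
    rw [this, Real.mul_rpow (pow_nonneg (by linarith) m) (by positivity), one_div (m : ℝ),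
      Real.pow_rpow_inv_natCast (by linarith) hm']
    ring
  have hp0 : 0 < p := hlow.trans_le hp.1
  change q p = _
  rw [← hgp p hp0]
  refine hfix p hp0 ?_ ?_
  · rw [hgp p hp0, ← priceCDF_lower hm hμ hμ1 hU]
    exact priceCDF_mono hμ hμ1 hU hlow hp.1
  · rw [← hgU]
    exact (hgmono p U hp0 hU).1 hp.2

end CDF

/-! ### From net values to the law of prices -/

section PriceLaw

variable {μ c : ℝ} {σ : Measure (Offer μ)} [IsProbabilityMeasure σ]

instance : IsProbabilityMeasure (σ.map price) :=
  Measure.isProbabilityMeasure_map measurable_price.aemeasurable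

/-- Under full information only the posteriors `0` and `1` occur; an event that excludes `0` is a
price event combined with the posterior `1`, which has probability `μ`. -/
lemma joint_real_of_fullInformation (hμ : 0 < μ) (hFI : ∀ᵐ a ∂σ, signal a = fullInformation μ)
    {S : Set (Offer μ × ℝ)} (hS : MeasurableSet S) {T : Set ℝ} (hT : MeasurableSet T)
    (h : ∀ a : Offer μ, signal a = fullInformation μ →
      (a, (0 : ℝ)) ∉ S ∧ ((a, (1 : ℝ)) ∈ S ↔ price a ∈ T)) :
    (joint σ).real S = μ * (σ.map price).real T := by
  have e : joint σ S = ENNReal.ofReal μ * σ (price ⁻¹' T) := by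
    rw [joint, Measure.compProd_apply hS, ← lintegral_indicator_one (measurable_price hT),
      ← lintegral_const_mul _ (measurable_one.indicator (measurable_price hT))]
    refine lintegral_congr_ae ?_
    filter_upwards [hFI] with a ha
    obtain ⟨h0, h1⟩ := h a ha
    rw [signalKernel_apply, ha, fullInformation, Measure.add_apply, Measure.smul_apply,
      Measure.smul_apply, Measure.dirac_apply' _ (measurable_prodMk_left hS),
      Measure.dirac_apply' _ (measurable_prodMk_left hS),
      Set.indicator_of_notMem (show (0 : ℝ) ∉ Prod.mk a ⁻¹' S from h0), smul_zero, zero_add]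
    by_cases hT' : price a ∈ T
    · rw [Set.indicator_of_mem (show (1 : ℝ) ∈ Prod.mk a ⁻¹' S from h1.2 hT'),
        Set.indicator_of_mem (show a ∈ price ⁻¹' T from hT')]
      rfl
    · rw [Set.indicator_of_notMem (show (1 : ℝ) ∉ Prod.mk a ⁻¹' S from fun h => hT' (h1.1 h)),
        Set.indicator_of_notMem (show a ∉ price ⁻¹' T from hT')]
      simp
  rw [map_measureReal_apply measurable_price hT, measureReal_def, measureReal_def, e,
    ENNReal.toReal_mul, ENNReal.toReal_ofReal hμ.le]

lemma netTruncated_zero (hcμ : c ≤ μ) (a : Offer μ) : netTruncated c (a, 0) = - price a := by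
  rw [netTruncated, truncated, min_eq_left (reservation_mem hcμ a).1.1, zero_sub]

lemma netTruncated_one (hμ : 0 < μ) (hc : 0 ≤ c) (hcμ : c < μ) (hμ1 : μ ≤ 1) {a : Offer μ}
    (ha : signal a = fullInformation μ) :
    netTruncated c (a, 1) = maxReservation μ c - price a := by
  rw [netTruncated, truncated_one hμ hc hcμ hμ1 ha]

lemma netCDF_of_fullInformation (hμ : 0 < μ) (hc : 0 ≤ c) (hcμ : c < μ) (hμ1 : μ ≤ 1)
    (hFI : ∀ᵐ a ∂σ, signal a = fullInformation μ) {t : ℝ} (ht : 0 ≤ t) :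
    netCDF c σ t = 1 - μ * (σ.map price).real (Set.Iio (maxReservation μ c - t)) := by
  have hS : MeasurableSet {z : Offer μ × ℝ | netTruncated c z ≤ t} :=
    measurableSet_le (measurable_netTruncated hcμ.le) measurable_const
  rw [← joint_real_of_fullInformation hμ hFI hS.compl measurableSet_Iio,
    probReal_compl_eq_one_sub hS, netCDF]
  · ring
  · intro a ha
    change ¬ ¬ netTruncated c (a, 0) ≤ t ∧ (¬ netTruncated c (a, 1) ≤ t ↔
      price a < maxReservation μ c - t)
    rw [netTruncated_zero hcμ.le, netTruncated_one hμ hc hcμ hμ1 ha, not_not, not_le]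
    exact ⟨by linarith [price_nonneg a], lt_sub_comm⟩

/-- Here `t` must be positive: at `t = 0` a free offer with posterior `0` also reaches the net value
`t`. -/
lemma netCDFLeft_of_fullInformation (hμ : 0 < μ) (hc : 0 ≤ c) (hcμ : c < μ) (hμ1 : μ ≤ 1)
    (hFI : ∀ᵐ a ∂σ, signal a = fullInformation μ) {t : ℝ} (ht : 0 < t) :
    netCDFLeft c σ t = 1 - μ * (σ.map price).real (Set.Iic (maxReservation μ c - t)) := by
  have hS : MeasurableSet {z : Offer μ × ℝ | netTruncated c z < t} :=
    measurableSet_lt (measurable_netTruncated hcμ.le) measurable_const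
  rw [← joint_real_of_fullInformation hμ hFI hS.compl measurableSet_Iic,
    probReal_compl_eq_one_sub hS, netCDFLeft]
  · ring
  · intro a ha
    change ¬ ¬ netTruncated c (a, 0) < t ∧ (¬ netTruncated c (a, 1) < t ↔
      price a ≤ maxReservation μ c - t)
    rw [netTruncated_zero hcμ.le, netTruncated_one hμ hc hcμ hμ1 ha, not_not, not_lt]
    exact ⟨by linarith [price_nonneg a], le_sub_comm⟩

lemma map_price_singleton (hμ : 0 < μ) (hc : 0 ≤ c) (hcμ : c < μ) (hμ1 : μ ≤ 1)
    (hFI : ∀ᵐ a ∂σ, signal a = fullInformation μ)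
    (hle : ∀ᵐ a ∂σ, price a ≤ maxReservation μ c)
    (h : ∀ t, 0 ≤ t → joint σ {z | netTruncated c z = t} = 0) (p : ℝ) :
    σ.map price {p} = 0 := by
  rcases lt_or_ge (maxReservation μ c) p with hp | hp
  · rw [Measure.map_apply measurable_price (measurableSet_singleton p),
      measure_eq_zero_iff_ae_notMem]
    filter_upwards [hle] with a ha
    intro (h : price a = p)
    linarith
  -- The clause on the posterior excludes a free offer with posterior `0`, which would share the net
  -- value `0` when `p = Ū`.
  · have hS : MeasurableSet {z : Offer μ × ℝ | netTruncated c z = maxReservation μ c - p ∧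
        z.2 = 1} :=
      (measurableSet_eq_fun (measurable_netTruncated hcμ.le) measurable_const).inter
        (measurableSet_eq_fun measurable_snd measurable_const)
    have e := joint_real_of_fullInformation hμ hFI hS (measurableSet_singleton p) (by
      intro a ha
      change ¬ (_ ∧ (0 : ℝ) = 1) ∧ ((netTruncated c (a, 1) = _ ∧ (1 : ℝ) = 1) ↔ price a = p)
      rw [netTruncated_one hμ hc hcμ hμ1 ha]
      simp)
    have h0 : (joint σ).real {z : Offer μ × ℝ | netTruncated c z = maxReservation μ c - p ∧
        z.2 = 1} = 0 :=
      (measureReal_eq_zero_iff).2 (measure_mono_null (fun z hz => hz.1) (h _ (sub_nonneg.2 hp)))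
    rw [h0] at e
    exact (measureReal_eq_zero_iff).1 ((mul_eq_zero.1 e.symm).resolve_left hμ.ne')

/-- In equilibrium, prices are distributed according to `priceCDF`. -/
theorem IsSymmetricEquilibrium.price_law {m : ℕ} {γ : ConsumerStrategy (m + 1) μ}
    (h : IsSymmetricEquilibrium (m + 1) c σ γ)
    (hm : 1 ≤ m) (hμ : 0 < μ) (hc : 0 ≤ c) (hcμ : c < μ) (hμ1 : μ < 1) {p : ℝ}
    (hp : p ∈ Set.Icc ((1 - μ) ^ m * maxReservation μ c) (maxReservation μ c)) :
    (σ.map price).real (Set.Iic p) = priceCDF μ (maxReservation μ c) m p := by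
  have hU := maxReservation_pos hμ hcμ
  have hπ := h.expectedProfit_pos hμ hc hcμ hμ1 0
  have hall := h.ae_fullInformation hm hμ hc hcμ hμ1 0
  have hFI : ∀ᵐ a ∂σ, signal a = fullInformation μ := hall.mono fun a ha => ha.1
  have hQ := map_price_singleton hμ hc hcμ hμ1.le hFI (hall.mono fun a ha => ha.2.2.1)
    fun t ht => h.joint_netTruncated_eq hm hμ hc hcμ hμ1 ht
  have hIio : ∀ p, (σ.map price).real (Set.Iio p) = (σ.map price).real (Set.Iic p) := fun p => by
    refine measureReal_congr ?_
    rw [← Set.Iio_union_right]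
    refine (union_ae_eq_left_iff_ae_subset.2 ?_).symm
    refine Filter.Eventually.mono (measure_eq_zero_iff_ae_notMem.1 (hQ p)) fun x hx hx' => ?_
    exact absurd hx' hx
  have hG : ∀ p, p ≤ maxReservation μ c → netCDF c σ (maxReservation μ c - p) =
      1 - μ * (σ.map price).real (Set.Iic p) := fun p hp => by
    rw [netCDF_of_fullInformation hμ hc hcμ hμ1.le hFI (sub_nonneg.2 hp), sub_sub_cancel, hIio]
  have hm1 : MeasurableSet {p : ℝ | 0 < p ∧ p ≤ maxReservation μ c} := measurableSet_Ioc
  have hm2 : MeasurableSet {p : ℝ | p * (1 - μ * (σ.map price).real (Set.Iic p)) ^ m =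
      expectedProfit γ (fun _ => σ) 0 / μ} := by
    have := (continuous_real_Iic hQ).measurable
    exact measurableSet_eq_fun (by fun_prop) measurable_const
  refine real_Iic_eq_priceCDF hm hμ hμ1 hU hQ
    ((ae_map_iff measurable_price.aemeasurable hm1).2 (hall.mono fun a ha => ⟨ha.2.1, ha.2.2.1⟩))
    (K := expectedProfit γ (fun _ => σ) 0 / μ) (div_pos hπ hμ) ?_
    ((ae_map_iff measurable_price.aemeasurable hm2).2 ?_) hp
  · intro p hp0 hpU
    rw [← hG p hpU, le_div_iff₀ hμ]
    have := h.netCDF_pow_le hμ hc hcμ hμ1.le 0 (t := maxReservation μ c - p) (by linarith)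
      (by linarith)
    rw [sub_sub_cancel] at this
    linarith
  · filter_upwards [hall] with a ha
    rw [← hG _ ha.2.2.1]
    exact ha.2.2.2

/-- A law of fully revealing offers is determined by the distribution function of its prices. -/
theorem eq_of_price_law {m : ℕ} {σ' : Measure (Offer μ)} [IsProbabilityMeasure σ']
    (hm : 1 ≤ m) (hμ : 0 < μ) (hcμ : c < μ) (hμ1 : μ < 1)
    (h : ∀ ν ∈ ({σ, σ'} : Set (Measure (Offer μ))),
      (∀ᵐ a ∂ν, signal a = fullInformation μ) ∧
      ∀ p ∈ Set.Icc ((1 - μ) ^ m * maxReservation μ c) (maxReservation μ c),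
        (ν.map price).real (Set.Iic p) = priceCDF μ (maxReservation μ c) m p) : σ' = σ := by
  have hU := maxReservation_pos hμ hcμ
  have hUmem : maxReservation μ c ∈
      Set.Icc ((1 - μ) ^ m * maxReservation μ c) (maxReservation μ c) :=
    ⟨mul_le_of_le_one_left hU.le (pow_le_one₀ (by linarith) (by linarith)), le_rfl⟩
  -- The endpoint values `0` and `1` of `priceCDF` fix the distribution function outside the
  -- interval too.
  have hval : ∀ p, ∃ v, ∀ ν ∈ ({σ, σ'} : Set (Measure (Offer μ))),
      (ν.map price).real (Set.Iic p) = v := by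
    intro p
    rcases le_or_gt p (maxReservation μ c) with h1 | h1
    · rcases le_or_gt ((1 - μ) ^ m * maxReservation μ c) p with h2 | h2
      · exact ⟨_, fun ν hν => (h ν hν).2 p ⟨h2, h1⟩⟩
      · refine ⟨0, fun ν hν => ?_⟩
        have : IsProbabilityMeasure ν := by
          rcases hν with rfl | rfl <;> infer_instance
        refine le_antisymm ?_ measureReal_nonneg
        rw [← priceCDF_lower hm hμ hμ1 hU, ← (h ν hν).2 _ ⟨le_rfl, hUmem.1⟩]
        exact measureReal_mono (Set.Iic_subset_Iic.2 h2.le)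
    · refine ⟨1, fun ν hν => ?_⟩
      have : IsProbabilityMeasure ν := by
        rcases hν with rfl | rfl <;> infer_instance
      refine le_antisymm measureReal_le_one ?_
      rw [← priceCDF_upper (m := m) hμ hU, ← (h ν hν).2 _ hUmem]
      exact measureReal_mono (Set.Iic_subset_Iic.2 h1.le)
  have hfst : σ'.map Prod.fst = σ.map Prod.fst := by
    have := Measure.isProbabilityMeasure_map (μ := σ) measurable_fst.aemeasurable
    have := Measure.isProbabilityMeasure_map (μ := σ') measurable_fst.aemeasurable
    refine Measure.ext_of_Iic _ _ fun p => ?_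
    obtain ⟨v, hv⟩ := hval p
    have e : ∀ ν : Measure (Offer μ), ν.map Prod.fst (Set.Iic p) =
        ν.map price (Set.Iic (p : ℝ)) := fun ν => by
      rw [Measure.map_apply measurable_fst measurableSet_Iic,
        Measure.map_apply measurable_price measurableSet_Iic]
      rfl
    rw [e, e, ← ENNReal.toReal_eq_toReal_iff' (measure_ne_top _ _) (measure_ne_top _ _)]
    exact (hv σ' (by simp)).trans (hv σ (by simp)).symm
  -- With the signal almost surely fixed, an offer is recovered from its price.
  have hrec : ∀ ν ∈ ({σ, σ'} : Set (Measure (Offer μ))),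
      ν = (ν.map Prod.fst).map (fullOffer hμ.le hμ1.le) := fun ν hν => by
    have hfo : Measurable (fullOffer hμ.le hμ1.le) := measurable_id.prodMk measurable_const
    rw [Measure.map_map hfo measurable_fst]
    conv_lhs => rw [← Measure.map_id (μ := ν)]
    refine Measure.map_congr ?_
    filter_upwards [(h ν hν).1] with a ha
    exact Prod.ext rfl (Subtype.ext ha)
  rw [hrec σ (by simp), hrec σ' (by simp), hfst]

end PriceLaw

/-! ### Existence of an equilibrium -/

section Existence

variable {μ U : ℝ} {m : ℕ}

/-- The indifference condition from which `priceCDF` is obtained; its constant is the price at which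
a fully revealing firm faces no cheaper rival. -/
lemma one_sub_mul_priceCDF_pow (hm : 1 ≤ m) (hμ : 0 < μ) (hU : 0 < U) {p : ℝ} (hp : 0 < p) :
    p * (1 - μ * priceCDF μ U m p) ^ m = (1 - μ) ^ m * U := by
  have e : 1 - μ * priceCDF μ U m p = (1 - μ) * (U / p) ^ (1 / (m : ℝ)) := by
    rw [priceCDF]; field_simp; ring
  rw [e, mul_pow, one_div, Real.rpow_inv_natCast_pow (by positivity) (by omega)]
  field_simp

lemma priceCDF_strictMono (hm : 1 ≤ m) (hμ : 0 < μ) (hμ1 : μ < 1) (hU : 0 < U) {p q : ℝ}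
    (hp : 0 < p) (hpq : p < q) : priceCDF μ U m p < priceCDF μ U m q := by
  have h1 : 0 < (1 - μ) / μ := div_pos (by linarith) hμ
  have hq : 0 < q := hp.trans hpq
  have hmR : (0 : ℝ) < m := by exact_mod_cast (by omega : 0 < m)
  have h2 : (U / q) ^ (1 / (m : ℝ)) < (U / p) ^ (1 / (m : ℝ)) :=
    Real.rpow_lt_rpow (by positivity) (div_lt_div_of_pos_left hU hp hpq) (by positivity)
  rw [priceCDF, priceCDF]
  linarith [mul_lt_mul_of_pos_left h2 h1]

/-- The quantile function of the equilibrium price. -/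
def priceQuantile (μ U : ℝ) (m : ℕ) (u : ℝ) : ℝ := U * ((1 - μ) / (1 - μ * u)) ^ m

lemma measurable_priceQuantile : Measurable (priceQuantile μ U m) := by
  unfold priceQuantile; fun_prop

lemma priceQuantile_pos (hμ : 0 < μ) (hμ1 : μ < 1) (hU : 0 < U) {u : ℝ}
    (hu : u ∈ Set.Icc (0 : ℝ) 1) : 0 < priceQuantile μ U m u :=
  mul_pos hU (pow_pos (div_pos (by linarith) (by nlinarith [hu.2])) m)

lemma priceCDF_priceQuantile (hm : 1 ≤ m) (hμ : 0 < μ) (hμ1 : μ < 1) (hU : 0 < U) {u : ℝ}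
    (hu : u ∈ Set.Icc (0 : ℝ) 1) : priceCDF μ U m (priceQuantile μ U m u) = u := by
  have h1 : 0 < 1 - μ := by linarith
  have h2 : 0 < 1 - μ * u := by nlinarith [hu.2]
  have e : U / priceQuantile μ U m u = ((1 - μ * u) / (1 - μ)) ^ m := by
    rw [priceQuantile, div_pow, div_pow]; field_simp
  rw [priceCDF, e, one_div (m : ℝ), Real.pow_rpow_inv_natCast (by positivity) (by omega)]
  field_simp
  ring

lemma priceQuantile_le_iff (hm : 1 ≤ m) (hμ : 0 < μ) (hμ1 : μ < 1) (hU : 0 < U) {u p : ℝ}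
    (hu : u ∈ Set.Icc (0 : ℝ) 1) (hp : 0 < p) :
    priceQuantile μ U m u ≤ p ↔ u ≤ priceCDF μ U m p := by
  have hq := priceQuantile_pos (m := m) hμ hμ1 hU hu
  conv_rhs => rw [← priceCDF_priceQuantile hm hμ hμ1 hU hu]
  refine ⟨priceCDF_mono hμ hμ1 hU hq, fun h => ?_⟩
  by_contra hlt
  exact h.not_gt (priceCDF_strictMono hm hμ hμ1 hU hp (not_le.1 hlt))

lemma priceQuantile_lt_iff (hm : 1 ≤ m) (hμ : 0 < μ) (hμ1 : μ < 1) (hU : 0 < U) {u p : ℝ}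
    (hu : u ∈ Set.Icc (0 : ℝ) 1) (hp : 0 < p) :
    priceQuantile μ U m u < p ↔ u < priceCDF μ U m p := by
  have hq := priceQuantile_pos (m := m) hμ hμ1 hU hu
  conv_rhs => rw [← priceCDF_priceQuantile hm hμ hμ1 hU hu]
  refine ⟨priceCDF_strictMono hm hμ hμ1 hU hq, fun h => ?_⟩
  by_contra hlt
  exact h.not_ge (priceCDF_mono hμ hμ1 hU hp (not_lt.1 hlt))

lemma priceCDF_mem_Icc (hm : 1 ≤ m) (hμ : 0 < μ) (hμ1 : μ < 1) (hU : 0 < U) {p : ℝ}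
    (hp : p ∈ Set.Icc ((1 - μ) ^ m * U) U) : priceCDF μ U m p ∈ Set.Icc (0 : ℝ) 1 := by
  have hlow : 0 < (1 - μ) ^ m * U := mul_pos (pow_pos (by linarith) m) hU
  refine ⟨?_, ?_⟩
  · rw [← priceCDF_lower hm hμ hμ1 hU]; exact priceCDF_mono hμ hμ1 hU hlow hp.1
  · rw [← priceCDF_upper (m := m) hμ hU]
    exact priceCDF_mono hμ hμ1 hU (hlow.trans_le hp.1) hp.2

/-- The equilibrium strategy: full information, at prices drawn from `priceCDF`. -/
def equilibriumStrategy (h0 : 0 ≤ μ) (h1 : μ ≤ 1) (U : ℝ) (m : ℕ) : Measure (Offer μ) :=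
  (volume.restrict (Set.Icc (0 : ℝ) 1)).map
    fun u => fullOffer h0 h1 (priceQuantile μ U m u).toNNReal

variable (h0 : 0 ≤ μ) (h1 : μ ≤ 1)

lemma measurable_fullOffer_priceQuantile :
    Measurable fun u => fullOffer h0 h1 (priceQuantile μ U m u).toNNReal :=
  (measurable_priceQuantile.real_toNNReal).prodMk measurable_const

instance : IsProbabilityMeasure (equilibriumStrategy h0 h1 U m) := by
  have : IsProbabilityMeasure (volume.restrict (Set.Icc (0 : ℝ) 1)) := ⟨by simp⟩
  exact Measure.isProbabilityMeasure_map (measurable_fullOffer_priceQuantile h0 h1).aemeasurable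

lemma ae_equilibriumStrategy_fullInformation :
    ∀ᵐ a ∂(equilibriumStrategy h0 h1 U m), signal a = fullInformation μ := by
  have hF := isProbabilityMeasure_fullInformation h0 h1
  have hmeas : ∀ (S : Set ℝ), MeasurableSet S →
      MeasurableSet {a : Offer μ | signal a S = fullInformation μ S} := fun S hS =>
    measurableSet_eq_fun ((signalKernel μ).measurable_coe hS) measurable_const
  -- The claim is true by construction; only measurability of the event needs work, and rational
  -- half-lines reduce it to countably many conditions.
  have hset : {a : Offer μ | signal a = fullInformation μ} =
      ⋂ q : ℚ, {a : Offer μ | signal a (Set.Iic (q : ℝ)) =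
        fullInformation μ (Set.Iic (q : ℝ))} := by
    ext a
    simp only [Set.mem_iInter]
    change signal a = fullInformation μ ↔ ∀ q : ℚ, signal a (Set.Iic (q : ℝ)) =
        fullInformation μ (Set.Iic (q : ℝ))
    refine ⟨fun h q => by rw [h], fun h => ?_⟩
    refine ext_of_generate_finite _ Real.borel_eq_generateFrom_Iic_rat
      Real.isPiSystem_Iic_rat ?_ (by simp)
    rintro _ ⟨_, ⟨q, rfl⟩, rfl⟩
    exact h q
  have hmS : MeasurableSet {a : Offer μ | signal a = fullInformation μ} := by
    rw [hset]
    exact MeasurableSet.iInter fun q => hmeas _ measurableSet_Iic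
  exact (ae_map_iff (measurable_fullOffer_priceQuantile h0 h1).aemeasurable hmS).2
    (Filter.Eventually.of_forall fun u => rfl)

lemma map_price_equilibriumStrategy (hμ : 0 < μ) (hμ1 : μ < 1) (hU : 0 < U) {S : Set ℝ}
    (hS : MeasurableSet S) : (equilibriumStrategy h0 h1 U m).map price S =
      volume ({u | priceQuantile μ U m u ∈ S} ∩ Set.Icc (0 : ℝ) 1) := by
  have hmeas := measurable_fullOffer_priceQuantile (U := U) (m := m) h0 h1
  rw [equilibriumStrategy, Measure.map_map measurable_price hmeas,
    Measure.map_apply (measurable_price.comp hmeas) hS,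
    Measure.restrict_apply (measurable_price.comp hmeas hS)]
  congr 1
  ext u
  refine and_congr_left fun hu => ?_
  change ((priceQuantile μ U m u).toNNReal : ℝ) ∈ S ↔ priceQuantile μ U m u ∈ S
  rw [Real.coe_toNNReal _ (priceQuantile_pos hμ hμ1 hU hu).le]

lemma map_price_Iic (hm : 1 ≤ m) (hμ : 0 < μ) (hμ1 : μ < 1) (hU : 0 < U) {p : ℝ}
    (hp : p ∈ Set.Icc ((1 - μ) ^ m * U) U) :
    ((equilibriumStrategy h0 h1 U m).map price).real (Set.Iic p) = priceCDF μ U m p := by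
  have hp0 : 0 < p := (mul_pos (pow_pos (by linarith) m) hU).trans_le hp.1
  have hc := priceCDF_mem_Icc hm hμ hμ1 hU hp
  have e : {u | priceQuantile μ U m u ∈ Set.Iic p} ∩ Set.Icc (0 : ℝ) 1 =
      Set.Icc 0 (priceCDF μ U m p) := by
    ext u
    change priceQuantile μ U m u ≤ p ∧ u ∈ Set.Icc (0 : ℝ) 1 ↔ _
    constructor
    · rintro ⟨h, hu⟩
      exact ⟨hu.1, (priceQuantile_le_iff hm hμ hμ1 hU hu hp0).1 h⟩
    · intro h
      have hu : u ∈ Set.Icc (0 : ℝ) 1 := ⟨h.1, h.2.trans hc.2⟩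
      exact ⟨(priceQuantile_le_iff hm hμ hμ1 hU hu hp0).2 h.2, hu⟩
  rw [measureReal_def, map_price_equilibriumStrategy h0 h1 hμ hμ1 hU measurableSet_Iic, e]
  simp [hc.1]

lemma map_price_Iio (hm : 1 ≤ m) (hμ : 0 < μ) (hμ1 : μ < 1) (hU : 0 < U) {p : ℝ}
    (hp : p ∈ Set.Icc ((1 - μ) ^ m * U) U) :
    ((equilibriumStrategy h0 h1 U m).map price).real (Set.Iio p) = priceCDF μ U m p := by
  have hp0 : 0 < p := (mul_pos (pow_pos (by linarith) m) hU).trans_le hp.1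
  have hc := priceCDF_mem_Icc hm hμ hμ1 hU hp
  have e : {u | priceQuantile μ U m u ∈ Set.Iio p} ∩ Set.Icc (0 : ℝ) 1 =
      Set.Ico 0 (priceCDF μ U m p) := by
    ext u
    change priceQuantile μ U m u < p ∧ u ∈ Set.Icc (0 : ℝ) 1 ↔ _
    constructor
    · rintro ⟨h, hu⟩
      exact ⟨hu.1, (priceQuantile_lt_iff hm hμ hμ1 hU hu hp0).1 h⟩
    · intro h
      have hu : u ∈ Set.Icc (0 : ℝ) 1 := ⟨h.1, h.2.le.trans hc.2⟩
      exact ⟨(priceQuantile_lt_iff hm hμ hμ1 hU hu hp0).2 h.2, hu⟩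
  rw [measureReal_def, map_price_equilibriumStrategy h0 h1 hμ hμ1 hU measurableSet_Iio, e]
  simp [hc.1]

lemma lower_mem_Icc (hμ : 0 ≤ μ) (hμ1 : μ ≤ 1) (hU : 0 < U) :
    (1 - μ) ^ m * U ∈ Set.Icc ((1 - μ) ^ m * U) U :=
  ⟨le_rfl, mul_le_of_le_one_left hU.le (pow_le_one₀ (by linarith) (by linarith))⟩

lemma ae_map_price (hm : 1 ≤ m) (hμ : 0 < μ) (hμ1 : μ < 1) (hU : 0 < U) :
    ∀ᵐ p ∂((equilibriumStrategy h0 h1 U m).map price),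
      p ∈ Set.Ioo ((1 - μ) ^ m * U) U := by
  have hl := lower_mem_Icc (m := m) h0 h1 hU
  have e1 : (equilibriumStrategy h0 h1 U m).map price (Set.Iic ((1 - μ) ^ m * U)) = 0 := by
    rw [← measureReal_eq_zero_iff, map_price_Iic h0 h1 hm hμ hμ1 hU hl,
      priceCDF_lower hm hμ hμ1 hU]
  have e2 : (equilibriumStrategy h0 h1 U m).map price (Set.Iio U)ᶜ = 0 := by
    rw [← measureReal_eq_zero_iff, probReal_compl_eq_one_sub measurableSet_Iio,
      map_price_Iio h0 h1 hm hμ hμ1 hU ⟨hl.2, le_rfl⟩, priceCDF_upper hμ hU, sub_self]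
  filter_upwards [measure_eq_zero_iff_ae_notMem.1 e1, measure_eq_zero_iff_ae_notMem.1 e2]
    with p h1 h2
  exact ⟨not_le.1 h1, not_not.1 h2⟩

theorem support_map_price (hm : 1 ≤ m) (hμ : 0 < μ) (hμ1 : μ < 1) (hU : 0 < U) :
    ((equilibriumStrategy h0 h1 U m).map price).support = Set.Icc ((1 - μ) ^ m * U) U := by
  have hlow : 0 < (1 - μ) ^ m * U := mul_pos (pow_pos (by linarith) m) hU
  have hlt : (1 - μ) ^ m * U < U :=
    mul_lt_of_lt_one_left hU (pow_lt_one₀ (by linarith) (by linarith) (by omega))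
  -- Strict monotonicity of `priceCDF` gives mass to every subinterval.
  have hIoc : ∀ a b, (1 - μ) ^ m * U ≤ a → a < b → b ≤ U →
      0 < (equilibriumStrategy h0 h1 U m).map price (Set.Ioc a b) := by
    intro a b ha hab hb
    rw [pos_iff_ne_zero]
    intro hz
    have e : ((equilibriumStrategy h0 h1 U m).map price).real (Set.Iic b) ≤
        ((equilibriumStrategy h0 h1 U m).map price).real (Set.Iic a) + 0 := by
      rw [← Set.Iic_union_Ioc_eq_Iic hab.le]
      refine (measureReal_union_le _ _).trans (add_le_add le_rfl ?_)
      rw [(measureReal_eq_zero_iff).2 hz]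
    rw [map_price_Iic h0 h1 hm hμ hμ1 hU ⟨ha.trans hab.le, hb⟩,
      map_price_Iic h0 h1 hm hμ hμ1 hU ⟨ha, hab.le.trans hb⟩] at e
    linarith [priceCDF_strictMono hm hμ hμ1 hU (hlow.trans_le ha) hab]
  refine Set.Subset.antisymm ?_ fun x hx => ?_
  · exact Measure.support_subset_of_isClosed isClosed_Icc
      ((ae_map_price h0 h1 hm hμ hμ1 hU).mono fun p hp => ⟨hp.1.le, hp.2.le⟩)
  · rw [Measure.mem_support_iff_forall]
    intro V hV
    obtain ⟨ε, hε, hball⟩ := Metric.mem_nhds_iff.1 hV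
    -- The subinterval is taken to the right of `x`, except at the upper endpoint.
    rcases hx.2.lt_or_eq with hxU | hxU
    · refine (hIoc x (min U (x + ε / 2)) hx.1 (lt_min hxU (by linarith))
        (min_le_left _ _)).trans_le (measure_mono fun y hy => hball ?_)
      rw [Metric.mem_ball, Real.dist_eq, abs_of_pos (by linarith [hy.1])]
      linarith [hy.2.trans (min_le_right _ _)]
    · refine (hIoc (max ((1 - μ) ^ m * U) (x - ε / 2)) x (le_max_left _ _)
        (max_lt (by rw [hxU]; exact hlt) (by linarith)) hx.2).trans_le
        (measure_mono fun y hy => hball ?_)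
      rw [Metric.mem_ball, Real.dist_eq, abs_of_nonpos (by linarith [hy.2])]
      linarith [(le_max_right _ _).trans_lt hy.1]

variable {c : ℝ}

/-- Put `p = Ū - t`. In the price interval the indifference condition gives equality. Below it the
winning probability is at most one, and `p` itself is less than the lowest price. -/
lemma netCDF_equilibriumStrategy_le (hm : 1 ≤ m) (hμ : 0 < μ) (hc : 0 ≤ c) (hcμ : c < μ)
    (hμ1 : μ < 1) {t : ℝ} (ht0 : 0 ≤ t) (ht : t < maxReservation μ c) :
    netCDF c (equilibriumStrategy h0 h1 (maxReservation μ c) m) t ^ m *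
      (μ * (maxReservation μ c - t)) ≤ μ * ((1 - μ) ^ m * maxReservation μ c) := by
  have hU := maxReservation_pos hμ hcμ
  have hp : 0 < maxReservation μ c - t := by linarith
  rw [mul_left_comm]
  refine mul_le_mul_of_nonneg_left ?_ hμ.le
  rcases le_or_gt ((1 - μ) ^ m * maxReservation μ c) (maxReservation μ c - t) with h | h
  · rw [netCDF_of_fullInformation hμ hc hcμ h1 (ae_equilibriumStrategy_fullInformation h0 h1) ht0,
      map_price_Iio h0 h1 hm hμ hμ1 hU ⟨h, by linarith⟩, mul_comm,
      one_sub_mul_priceCDF_pow hm hμ hU hp]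
  · refine (mul_le_of_le_one_left hp.le ?_).trans h.le
    exact pow_le_one₀ (netCDF_nonneg t) (netCDF_le_one t)

/-- Almost every price drawn earns this amount by indifference, even if all ties are lost, since
prices have no atoms. -/
lemma le_expectedProfit_equilibriumStrategy (hm : 1 ≤ m) (hμ : 0 < μ) (hc : 0 ≤ c)
    (hcμ : c < μ) (hμ1 : μ < 1) {γ : ConsumerStrategy (m + 1) μ}
    (hγ : IsSequentiallyRational c γ) (i : Fin (m + 1)) :
    μ * ((1 - μ) ^ m * maxReservation μ c) ≤ expectedProfit γ
      (fun _ => equilibriumStrategy h0 h1 (maxReservation μ c) m) i := by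
  have hU := maxReservation_pos hμ hcμ
  have hlow : 0 < (1 - μ) ^ m * maxReservation μ c := mul_pos (pow_pos (by linarith) m) hU
  set σ := equilibriumStrategy h0 h1 (maxReservation μ c) m with hσ
  have hI := integrable_winningPrice_mul (m := m) (σ := σ) (τ := σ) hμ hc hcμ
  have h := integral_winningPrice_le (σ := σ) (τ := σ) hμ hc hcμ hγ i
  rw [update_self_const, integral_joint hI] at h
  refine le_trans ?_ h
  have hconst : ∫ _, μ * ((1 - μ) ^ m * maxReservation μ c) ∂σ =
      μ * ((1 - μ) ^ m * maxReservation μ c) := by simp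
  rw [← hconst]
  refine integral_mono_ae (integrable_const _) hI.integral_compProd ?_
  have hae := ae_of_ae_map measurable_price.aemeasurable (ae_map_price h0 h1 hm hμ hμ1 hU)
  have hFI := ae_equilibriumStrategy_fullInformation (U := maxReservation μ c) (m := m) h0 h1
  filter_upwards [hFI, hae] with a ha hp
  refine le_trans (le_of_eq ?_)
    (le_integral_winningPrice_fullInformation hμ hc hcμ h1 ha hp.2)
  rw [netCDFLeft_of_fullInformation hμ hc hcμ h1 hFI (by linarith [hp.2]), sub_sub_cancel,
    map_price_Iic h0 h1 hm hμ hμ1 hU ⟨hp.1.le, hp.2.le⟩,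
    one_sub_mul_priceCDF_pow hm hμ hU (hlow.trans hp.1)]

/-- The number `μ (1 - μ)^m Ū` is both a ceiling for every deviation and a floor for the profit
without deviation. -/
theorem isSymmetricEquilibrium_equilibriumStrategy (hm : 1 ≤ m) (hμ : 0 < μ) (hc : 0 ≤ c)
    (hcμ : c < μ) (hμ1 : μ < 1) :
    IsSymmetricEquilibrium (m + 1) c (equilibriumStrategy h0 h1 (maxReservation μ c) m)
      (indexStrategy (m + 1) μ c) where
  isProbabilityMeasure := inferInstance
  sequentiallyRational := isSequentiallyRational_indexStrategy hc hcμ.le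
  noDeviation i τ _ := by
    have hγ := isSequentiallyRational_indexStrategy (n := m + 1) hc hcμ.le
    exact (expectedProfit_le hμ hc hcμ
      (fun t => netCDF_equilibriumStrategy_le h0 h1 hm hμ hc hcμ hμ1) hγ i).trans
      (le_expectedProfit_equilibriumStrategy h0 h1 hm hμ hc hcμ hμ1 hγ i)

end Existence

end SearchMarket

end
theorem proposition3 (n : ℕ) (hn : 2 ≤ n) (μ c : ℝ) (hμ₀ : 0 < μ) (hμ₁ : μ < 1)
    (hc₀ : 0 ≤ c) (hcμ : c < μ) :
    ∃ σ : Measure (SearchMarket.Offer μ),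
      (∃ γ : SearchMarket.ConsumerStrategy n μ,
        SearchMarket.IsSymmetricEquilibrium n c σ γ) ∧
      (∀ (σ' : Measure (SearchMarket.Offer μ)) (γ' : SearchMarket.ConsumerStrategy n μ),
        SearchMarket.IsSymmetricEquilibrium n c σ' γ' → σ' = σ) ∧
      (∀ᵐ a ∂σ, SearchMarket.signal a = SearchMarket.fullInformation μ) ∧
      (σ.map SearchMarket.price).support =
        Set.Icc ((1 - μ) ^ (n - 1) * SearchMarket.maxReservation μ c)
          (SearchMarket.maxReservation μ c) ∧
      (∀ p ∈ Set.Icc ((1 - μ) ^ (n - 1) * SearchMarket.maxReservation μ c)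
          (SearchMarket.maxReservation μ c),
        (σ.map SearchMarket.price).real (Set.Iic p) =
          1 / μ - (1 - μ) / μ *
            (SearchMarket.maxReservation μ c / p) ^ (1 / ((n : ℝ) - 1))) := by
  obtain ⟨m, rfl⟩ : ∃ m, n = m + 1 := ⟨n - 1, by omega⟩
  have hm : 1 ≤ m := by omega
  have hU := SearchMarket.maxReservation_pos hμ₀ hcμ
  have hcdf := fun p hp => SearchMarket.map_price_Iic (p := p) hμ₀.le hμ₁.le hm hμ₀ hμ₁ hU hp
  have hFI := SearchMarket.ae_equilibriumStrategy_fullInformation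
    (U := SearchMarket.maxReservation μ c) (m := m) hμ₀.le hμ₁.le
  refine ⟨SearchMarket.equilibriumStrategy hμ₀.le hμ₁.le (SearchMarket.maxReservation μ c) m,
    ⟨_, SearchMarket.isSymmetricEquilibrium_equilibriumStrategy hμ₀.le hμ₁.le hm hμ₀ hc₀ hcμ hμ₁⟩,
    fun σ' γ' h => ?_, hFI, ?_, ?_⟩
  · have := h.isProbabilityMeasure
    refine SearchMarket.eq_of_price_law hm hμ₀ hcμ hμ₁ fun ν hν => ?_
    rcases hν with rfl | rfl
    · exact ⟨hFI, hcdf⟩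
    · exact ⟨(h.ae_fullInformation hm hμ₀ hc₀ hcμ hμ₁ 0).mono fun a ha => ha.1,
        fun p hp => h.price_law hm hμ₀ hc₀ hcμ hμ₁ hp⟩
  · exact SearchMarket.support_map_price hμ₀.le hμ₁.le hm hμ₀ hμ₁ hU
  · intro p hp
    have e : ((m + 1 : ℕ) : ℝ) - 1 = m := by push_cast; ring
    rw [e]
    exact hcdf p hp
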